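/- **Setting.** Let $W$ be a finite group isomorphic to the Weyl group of a crystallographic root system, acting from the right on everything below. Let $V$ be an irreducible right $\mathbb{Q}[W]$-module of finite dimension, and let $\mathbb{S}\subset V$ be a $W$-stable lattice (a finitely generated subgroup with $\mathbb{S}\otimes\mathbb{Q}=V$). Let $\lambda\in V$ be a weight of $\mathbb{S}$, i.e. $\lambda g-\lambda\in\mathbb{S}$ for all $g\in W$. Let $(\,,)$ be the negative definite $W$-invariant symmetric form on $V$ such that $(\lambda,\mu)\in\mathbb{Z}$ for all $\mu\in\mathbb{S}$ and such that every $W$-invariant symmetric form with this integrality property is an integer multiple of $(\,,)$. (Such a form exists only if $\lambda\neq 0$.) Let $H=\mathrm{Stab}(\lambda)\subset W$. Let $\pi:Z\to X$ be a Galois covering with group $W$ of smooth projective connected curves over $\mathbb{C}$ (equivalently, compact connected Riemann surfaces): $W$ acts faithfully on $Z$ by automorphisms $z\mapsto z^g$, and $\pi$ is the quotient by $W$. Let $\varphi:Z\to Y=Z/H$ be the quotient by $H$, and $\psi:Y\to X$ the induced map, so that $\pi=\psi\varphi$. A (rational) correspondence on a curve is a divisor with rational coefficients on the product of the curve with itself.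 *Schur correspondence.* On $Z$ put $S_\lambda=\sum_{g\in W}(\lambda g,\lambda)\,\Gamma_g$, where $\Gamma_g=\{(z,z^g)\}$ is the graph of $g$. On $Y$ put $\overline S_\lambda=(\varphi\times\varphi)_*S_\lambda$, the push-forward of divisors. *Kanev correspondence.* Let $U\subset X$ be the complement of the branch locus of $\pi$. Fix $\xi_0\in U$ and $z_0\in\pi^{-1}(\xi_0)$. If the lift to $Z$ with starting point $z_0$ of a loop $\gamma$ in $U$ at $\xi_0$ ends at $z_0^{w}$, send $\gamma$ to $w^{-1}$. This is a surjective homomorphism $\pi_1(U,\xi_0)\to W$, and the right monodromy action of $\pi_1(U,\xi_0)$ on $\psi^{-1}(\xi_0)$ factors through it. Identify $\psi^{-1}(\xi_0)$ with the orbit $\lambda W$ by the $W$-equivariant bijection under which $\varphi(z_0)$ corresponds to $\lambda$. For every $\xi\in U$ choose a path in $U$ from $\xi$ to $\xi_0$. For $y\in\psi^{-1}(\xi)$ let $\mu(y)\in\lambda W$ be the element corresponding to the end point of the lift to $Y$ of this path starting at $y$. Then $\overline K_\lambda$ is the closure in $Y\times Y$ of $$\{(x,y)\in\psi^{-1}(U)\times\psi^{-1}(U)\;:\;\psi(x)=\psi(y),\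 (\mu(x),\mu(y))-(\lambda,\lambda)-1>0\},$$ each irreducible component being counted with multiplicity $(\mu(x),\mu(y))-(\lambda,\lambda)-1$, where $(x,y)$ is a general point of the component. Let $\overline\Delta$ be the diagonal in $Y\times Y$ and let $\overline T=\psi^*\psi_*$ be the trace correspondence of $\psi$. **Theorem 3.5.** For all choices of $\xi_0$, $z_0$ and the paths, the following equality of divisors on $Y\times Y$ with rational coefficients holds: $$\overline S_\lambda=|H|^2\left(\overline K_\lambda-\overline\Delta+\big((\lambda,\lambda)+1\big)\,\overline T\right).$$ -/

import Mathlib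

open MulOpposite
open scoped Manifold ContDiff Topology

universe u

noncomputable section

namespace SchurKanev

/-! ### Compact Riemann surfaces and quotients by finite groups -/

/-- A smooth projective (connected) curve over `ℂ`, as a compact connected Riemann surface. -/
class IsCompactRiemannSurface (X : Type*) [TopologicalSpace X] [ChartedSpace ℂ X] : Prop
    extends T2Space X, CompactSpace X, ConnectedSpace X, IsManifold 𝓘(ℂ, ℂ) ω X

/-- Holomorphic maps between Riemann surfaces. -/
def IsHolomorphic {A B : Type*} [TopologicalSpace A] [ChartedSpace ℂ A]
    [TopologicalSpace B] [ChartedSpace ℂ B] (f : A → B) : Prop :=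
  ContMDiff 𝓘(ℂ, ℂ) 𝓘(ℂ, ℂ) ω f

/-- `p : Z → Q` is the quotient of the Riemann surface `Z` by the subgroup `H` of `W`, which acts
on `Z` from the right, `z ^ g = op g • z`: it is holomorphic and surjective and its fibres are
the `H`-orbits. (Such a `Q` is unique up to a unique isomorphism under `Z`.) -/
structure IsQuotientBy {W : Type*} [Group W] {Z Q : Type*} [MulAction Wᵐᵒᵖ Z]
    [TopologicalSpace Z] [ChartedSpace ℂ Z] [TopologicalSpace Q] [ChartedSpace ℂ Q]
    (H : Subgroup W) (p : Z → Q) : Prop where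
  holomorphic : IsHolomorphic p
  surjective : Function.Surjective p
  fibre : ∀ z z' : Z, p z = p z' ↔ ∃ h ∈ H, z' = op h • z

/-- The ramification index of a finite holomorphic map `f` of Riemann surfaces at `a`: the number
of preimages, in small neighbourhoods of `a`, of a general point close to `f a`. Fibres over special
points have fewer points, so this is `inf_N sup_b #(N ∩ f⁻¹(b))`, `N` running over the
neighbourhoods of `a`. -/
def ramificationIndex {A B : Type*} [TopologicalSpace A] (f : A → B) (a : A) : ℕ :=
  (⨅ N ∈ 𝓝 a, ⨆ b : B, (N ∩ f ⁻¹' {b}).encard).toNat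

/-- The images of the ramification points. -/
def branchLocus {A B : Type*} [TopologicalSpace A] (f : A → B) : Set B :=
  f '' {a | ramificationIndex f a ≠ 1}

/-! ### Curves on a product of two Riemann surfaces, and correspondences -/

/-- Irreducible (closed, one-dimensional) curves on the surface `A × B`: the images of the
nonconstant holomorphic maps from a compact connected Riemann surface (such as the normalization of
the curve) to `A × B`. -/
def IsIrreducibleCurve {A B : Type u} [TopologicalSpace A] [ChartedSpace ℂ A]
    [TopologicalSpace B] [ChartedSpace ℂ B] (C : Set (A × B)) : Prop :=
  C.Nontrivial ∧
  ∃ (R : Type u) (_ : TopologicalSpace R) (_ : ChartedSpace ℂ R) (_ : IsCompactRiemannSurface R)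
    (f : R → A) (g : R → B),
    IsHolomorphic f ∧ IsHolomorphic g ∧ C = Set.range (fun r => (f r, g r))

/-- The set of irreducible curves on `A × B`. -/
def IrreducibleCurve (A B : Type u) [TopologicalSpace A] [ChartedSpace ℂ A]
    [TopologicalSpace B] [ChartedSpace ℂ B] : Type u :=
  {C : Set (A × B) // IsIrreducibleCurve C}

/-- Rational correspondences between `A` and `B`: the divisors with rational coefficients on
the surface `A × B`, i.e. the finite formal `ℚ`-linear combinations of irreducible curves. -/
abbrev Correspondence (A B : Type u) [TopologicalSpace A] [ChartedSpace ℂ A]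
    [TopologicalSpace B] [ChartedSpace ℂ B] : Type u :=
  IrreducibleCurve A B →₀ ℚ

/-- The prime divisor `1 • C` if `C` is an irreducible curve, and `0` otherwise
(for instance if `C` is a point). -/
def primeDivisor {A B : Type u} [TopologicalSpace A] [ChartedSpace ℂ A]
    [TopologicalSpace B] [ChartedSpace ℂ B] (C : Set (A × B)) : Correspondence A B :=
  open Classical in
  if h : IsIrreducibleCurve C then Finsupp.single (⟨C, h⟩ : IrreducibleCurve A B) 1 else 0

/-- The value which `v` takes at all but finitely many points of `C`
(unique as `C` is infinite in all applications). -/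
def genericValue {M : Type*} (C : Set M) (v : M → ℚ) : ℚ :=
  open Classical in
  if h : ∃ q : ℚ, {p ∈ C | v p ≠ q}.Finite then h.choose else 0

/-- The degree of the map `C → F(C)` induced by `F`, i.e. the number of points of its general
fibre. -/
def mapDegree {M N : Type*} (F : M → N) (C : Set M) : ℚ :=
  genericValue (F '' C) fun q => ((C ∩ F ⁻¹' {q}).ncard : ℚ)

/-- The push-forward of divisors `(f × g)_*`: an irreducible curve `C` is sent to
`deg(C → (f × g)(C)) • (f × g)(C)`, which means `0` if `C` is contracted to a point. -/
def pushforward {A B A' B' : Type u}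
    [TopologicalSpace A] [ChartedSpace ℂ A] [TopologicalSpace B] [ChartedSpace ℂ B]
    [TopologicalSpace A'] [ChartedSpace ℂ A'] [TopologicalSpace B'] [ChartedSpace ℂ B']
    (f : A → A') (g : B → B') : Correspondence A B →ₗ[ℚ] Correspondence A' B' :=
  Finsupp.linearCombination ℚ fun C : IrreducibleCurve A B =>
    mapDegree (Prod.map f g) C.1 • primeDivisor (Prod.map f g '' C.1)

/-- The pull-back of divisors `(id × g)^*`, for a nonconstant holomorphic map `g : B' → B`:
an irreducible curve `D` is sent to `∑ e_C • C`, where `C` runs over the irreducible components of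
`(id × g)⁻¹(D)`, i.e. the irreducible curves contained in it, and `e_C` is the ramification index
of `id × g` along `C`, i.e. the one of `g` at `b` for a general point `(a, b)` of `C`. -/
def pullback {A B B' : Type u} [TopologicalSpace A] [ChartedSpace ℂ A]
    [TopologicalSpace B] [ChartedSpace ℂ B] [TopologicalSpace B'] [ChartedSpace ℂ B']
    (g : B' → B) : Correspondence A B →ₗ[ℚ] Correspondence A B' :=
  Finsupp.linearCombination ℚ fun D : IrreducibleCurve A B =>
    ∑ᶠ (C : IrreducibleCurve A B') (_ : C.1 ⊆ Prod.map id g ⁻¹' D.1),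
      genericValue C.1 (fun p => (ramificationIndex g p.2 : ℚ)) •
        (Finsupp.single C 1 : Correspondence A B')

/-- The graph of a map, as a correspondence. -/
def graph {A B : Type u} [TopologicalSpace A] [ChartedSpace ℂ A]
    [TopologicalSpace B] [ChartedSpace ℂ B] (f : A → B) : Correspondence A B :=
  primeDivisor {p : A × B | p.2 = f p.1}

/-- The diagonal in `Y × Y`. -/
def diagonal (Y : Type u) [TopologicalSpace Y] [ChartedSpace ℂ Y] : Correspondence Y Y :=
  primeDivisor {p : Y × Y | p.1 = p.2}

/-- The trace correspondence `ψ^* ψ_*` of `ψ : Y → X`. Here `ψ_*` is the correspondence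
`(id × ψ)_* Δ` between `Y` and `X` (the graph of `ψ`), and a correspondence `D` between `Y` and `X`
composed with `ψ^*` is `(id × ψ)^* D`. -/
def traceCorrespondence {X Y : Type u} [TopologicalSpace X] [ChartedSpace ℂ X]
    [TopologicalSpace Y] [ChartedSpace ℂ Y] (ψ : Y → X) : Correspondence Y Y :=
  pullback ψ (pushforward id ψ (diagonal Y))

section sanity

variable {A B : Type u} [TopologicalSpace A] [ChartedSpace ℂ A] [TopologicalSpace B]
  [ChartedSpace ℂ B]

theorem nontrivial_of_riemannSurface [IsCompactRiemannSurface A] : Nontrivial A := by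
  obtain ⟨a⟩ : Nonempty A := inferInstance
  by_contra h
  rw [not_nontrivial_iff_subsingleton] at h
  have ho : IsOpen ((chartAt ℂ a).target) := (chartAt ℂ a).open_target
  have hs : (chartAt ℂ a).target = {chartAt ℂ a a} := by
    ext w
    constructor
    · intro hw
      have := (chartAt ℂ a).right_inv hw
      rw [Set.mem_singleton_iff, ← this, Subsingleton.elim ((chartAt ℂ a).symm w) a]
    · rintro rfl
      exact (chartAt ℂ a).map_source (mem_chart_source ℂ a)
  rw [hs] at ho
  exact not_isOpen_singleton _ ho

/-- The graph of a holomorphic map is an irreducible curve. -/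
theorem isIrreducibleCurve_graph [hA : IsCompactRiemannSurface A] {f : A → B}
    (hf : IsHolomorphic f) : IsIrreducibleCurve {p : A × B | p.2 = f p.1} := by
  obtain ⟨a, b, hab⟩ := (nontrivial_of_riemannSurface (A := A)).exists_pair_ne
  refine ⟨⟨(a, f a), rfl, (b, f b), rfl, fun h => hab (congrArg Prod.fst h)⟩,
    A, inferInstance, inferInstance, hA, id, f, contMDiff_id, hf, ?_⟩
  ext ⟨x, y⟩
  simp [eq_comm]

/-- The diagonal is an irreducible curve. -/
theorem isIrreducibleCurve_diagonal [IsCompactRiemannSurface A] :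
    IsIrreducibleCurve {p : A × A | p.1 = p.2} := by
  have := isIrreducibleCurve_graph (A := A) (B := A) (f := id) contMDiff_id
  simpa [eq_comm] using this

end sanity

/-! ### Weyl groups, lattices, weights -/

/-- `W` is (isomorphic to) the Weyl group of a crystallographic root system. -/
def IsWeylGroup (W : Type*) [Group W] : Prop :=
  ∃ (n : ℕ) (ι : Type) (P : RootPairing ι ℚ (Fin n → ℚ) (Fin n → ℚ)),
    Finite ι ∧ P.IsRootSystem ∧ P.IsCrystallographic ∧ Nonempty (W ≃* P.weylGroup)

section weights

variable {W : Type*} [Group W] {V : Type*} [AddCommGroup V] [Module ℚ V]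

/-- `S` is a `W`-stable lattice in `V` for the right representation `v g = ρ (op g) v`: a finitely
generated subgroup with `S ⊗ ℚ = V`, stable under `W`. -/
structure IsInvariantLattice (ρ : Representation ℚ Wᵐᵒᵖ V) (S : Submodule ℤ V) : Prop where
  fg : S.FG
  span_eq_top : Submodule.span ℚ (S : Set V) = ⊤
  stable : ∀ (g : W), ∀ v ∈ S, ρ (op g) v ∈ S

/-- `lam` is a weight of the lattice `S`: `lam g - lam ∈ S` for all `g`. -/
def IsWeight (ρ : Representation ℚ Wᵐᵒᵖ V) (S : Submodule ℤ V) (lam : V) : Prop :=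
  ∀ g : W, ρ (op g) lam - lam ∈ S

/-- The stabilizer of `lam` in `W`. -/
def weightStabilizer (ρ : Representation ℚ Wᵐᵒᵖ V) (lam : V) : Subgroup W where
  carrier := {g | ρ (op g) lam = lam}
  one_mem' := by simp
  mul_mem' {a b} ha hb := by
    simp only [Set.mem_ofPred_eq] at ha hb ⊢
    rw [op_mul, map_mul, Module.End.mul_apply, ha, hb]
  inv_mem' {a} ha := by
    simp only [Set.mem_ofPred_eq] at ha ⊢
    conv_lhs => rw [← ha]
    rw [← Module.End.mul_apply, ← map_mul, ← op_mul, mul_inv_cancel, op_one, map_one,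
      Module.End.one_apply]

/-- `B` is symmetric and `W`-invariant, with `B(lam, μ) ∈ ℤ` for all `μ ∈ S`. -/
structure IsIntegralInvariantForm (ρ : Representation ℚ Wᵐᵒᵖ V) (S : Submodule ℤ V) (lam : V)
    (B : LinearMap.BilinForm ℚ V) : Prop where
  symm : ∀ v w : V, B v w = B w v
  invariant : ∀ (g : W) (v w : V), B (ρ (op g) v) (ρ (op g) w) = B v w
  integral : ∀ μ ∈ S, ∃ n : ℤ, B lam μ = n

/-- `B` is the normalized form attached to `(S, lam)`: the negative definite `W`-invariant symmetric
form with `B(lam, μ) ∈ ℤ` for all `μ ∈ S`, such that all `W`-invariant symmetric forms with this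
integrality property are integer multiples of it. -/
structure IsNormalizedForm (ρ : Representation ℚ Wᵐᵒᵖ V) (S : Submodule ℤ V) (lam : V)
    (B : LinearMap.BilinForm ℚ V) : Prop extends IsIntegralInvariantForm ρ S lam B where
  negDef : ∀ v : V, v ≠ 0 → B v v < 0
  minimal : ∀ B' : LinearMap.BilinForm ℚ V, IsIntegralInvariantForm ρ S lam B' →
    ∃ n : ℤ, B' = n • B

end weights

/-! ### The Schur correspondence -/

section schur

variable {W : Type*} [Group W] [Fintype W] {V : Type*} [AddCommGroup V] [Module ℚ V]
  {Y Z : Type u} [TopologicalSpace Z] [ChartedSpace ℂ Z] [MulAction Wᵐᵒᵖ Z]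
  [TopologicalSpace Y] [ChartedSpace ℂ Y]

variable (Z) in
/-- The Schur correspondence `∑_g (lam g, lam) Γ_g` on `Z`. -/
def schur (ρ : Representation ℚ Wᵐᵒᵖ V) (lam : V) (B : LinearMap.BilinForm ℚ V) :
    Correspondence Z Z :=
  ∑ g : W, B (ρ (op g) lam) lam • graph (fun z : Z => op g • z)

/-- The push-forward of the Schur correspondence to `Y`. -/
def schurBar (ρ : Representation ℚ Wᵐᵒᵖ V) (lam : V) (B : LinearMap.BilinForm ℚ V)
    (φ : Z → Y) : Correspondence Y Y :=
  pushforward φ φ (schur Z ρ lam B)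

end schur

/-! ### The Kanev correspondence -/

section kanev

variable {W : Type*} [Group W] {V : Type*} [AddCommGroup V] [Module ℚ V]
  {X Y Z : Type u} [TopologicalSpace X] [TopologicalSpace Y] [ChartedSpace ℂ Y]
  [TopologicalSpace Z] [MulAction Wᵐᵒᵖ Z]

/-- The choices made in the construction of the Kanev correspondence, `U` being the complement of
the branch locus of `π`: base points `ξ₀ ∈ U` and `z₀ ∈ π⁻¹(ξ₀)`; the labelling `ν` of the fibre
`ψ⁻¹(ξ₀)` by the orbit of `lam`, which is `W`-equivariant for the monodromy action; and a path in
`U` from `ξ` to `ξ₀` for each `ξ ∈ U`.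

If the lift to `Z` of a loop `γ` in `U` at `ξ₀` leads from `z₀` to `z₀ ^ w`, then the surjection
`π₁(U, ξ₀) → W` with kernel `π₁(π⁻¹(U), z₀)` sends `γ` to `w⁻¹` (`γ ↦ w` is an
antihomomorphism), and the right action of `γ` on the fibre sends `y` to the end point `y'` of
the lift to `Y` starting in `y`. -/
structure KanevMarking (ρ : Representation ℚ Wᵐᵒᵖ V) (lam : V)
    (π : Z → X) (φ : Z → Y) (ψ : Y → X) where
  ξ₀ : X
  ξ₀_mem : ξ₀ ∈ (branchLocus π)ᶜ
  z₀ : Z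
  π_z₀ : π z₀ = ξ₀
  ν : Y → V
  bijOn : Set.BijOn ν (ψ ⁻¹' {ξ₀}) (Set.range fun g : W => ρ (op g) lam)
  ν_base : ν (φ z₀) = lam
  equivariant : ∀ (w : W) (y y' : Y) (γ : Path ξ₀ ξ₀) (δ : Path z₀ (op w • z₀)) (ε : Path y y'),
    (∀ t, γ t ∈ (branchLocus π)ᶜ) → (∀ t, π (δ t) = γ t) → (∀ t, ψ (ε t) = γ t) →
      ν y' = ρ (op w⁻¹) (ν y)
  path : ∀ ξ ∈ (branchLocus π)ᶜ, Path ξ ξ₀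
  path_mem : ∀ (ξ : X) (hξ : ξ ∈ (branchLocus π)ᶜ) (t : unitInterval),
    path ξ hξ t ∈ (branchLocus π)ᶜ

namespace KanevMarking

variable {ρ : Representation ℚ Wᵐᵒᵖ V} {lam : V} {π : Z → X} {φ : Z → Y} {ψ : Y → X}

/-- The map `μ` from `ψ⁻¹(U)` to the orbit of `lam`: the label of the end point `y'` of the lift
starting at `y` of the path chosen for `ψ y` (and `0` outside `ψ⁻¹(U)`). -/
def μ (m : KanevMarking ρ lam π φ ψ) (y : Y) : V :=
  open Classical in
  if h : ψ y ∈ (branchLocus π)ᶜ then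
    m.ν (@Classical.epsilon Y ⟨y⟩ fun y' =>
      ∃ ε : Path y y', ∀ t, ψ (ε t) = m.path (ψ y) h t)
  else 0

/-- The multiplicity `(μ(x), μ(y)) - (lam, lam) - 1` of the pair `(x, y)`. -/
def multiplicity (m : KanevMarking ρ lam π φ ψ) (B : LinearMap.BilinForm ℚ V)
    (p : Y × Y) : ℚ :=
  B (m.μ p.1) (m.μ p.2) - B lam lam - 1

/-- The pairs of points over the same point of `U` with positive multiplicity. -/
def kanevSet (m : KanevMarking ρ lam π φ ψ) (B : LinearMap.BilinForm ℚ V) : Set (Y × Y) :=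
  {p | ψ p.1 ∈ (branchLocus π)ᶜ ∧ ψ p.2 ∈ (branchLocus π)ᶜ ∧ ψ p.1 = ψ p.2 ∧
    0 < m.multiplicity B p}

/-- The Kanev correspondence on `Y`: the closure of `kanevSet`, each irreducible component `C`
(i.e. each irreducible curve contained in the closure) being counted with the multiplicity
`(μ(x), μ(y)) - (lam, lam) - 1` of its general points `(x, y)`. -/
def kanev (m : KanevMarking ρ lam π φ ψ) (B : LinearMap.BilinForm ℚ V) : Correspondence Y Y :=
  ∑ᶠ (C : IrreducibleCurve Y Y) (_ : C.1 ⊆ closure (m.kanevSet B)),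
    genericValue C.1 (m.multiplicity B) • (Finsupp.single C 1 : Correspondence Y Y)

end KanevMarking

end kanev

end SchurKanev

end

/-! Write `C_g` for `orbitCurve φ g`, the image in `Y × Y` of the graph of `g`. All divisors in the
identity are supported on these finitely many curves, so it suffices to compare the coefficients at
each `C_g`. Two facts make this possible: `C_g` depends only on the double coset `H g H`
(`orbitCurve_eq_iff`), and every irreducible curve of pairs with equal image in `X` is some `C_g`
(`exists_eq_orbitCurve`).

Schur: the graph of `g` covers `C_g` with degree `|H ∩ g H g⁻¹|`, and these degrees add up to `|H|²`
over a double coset (`sum_graphDegree`). As `(λg, λ)` is constant on double cosets, the coefficient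
is `|H|² (λg, λ)`. Trace: the coefficient is `1`, because `ψ` is unramified at the image of a point
of `Z` with trivial stabilizer. Diagonal: this is `C_1`.

Kanev: the labels `μ` of a fibre are determined up to one common element of `W`, so by invariance of
the form the multiplicity at a general point of `C_g` is `(λg, λ) - (λ, λ) - 1`, whatever the
choices (`multiplicity_orbitMap`). Only positive multiplicities are counted. For `g ∉ H` nothing is
lost: `(λ, λg - λ)` is an integer, and it is positive because the form is negative definite, so the
multiplicity is at least `0` (`multiplicity_nonneg`). For `g ∈ H` the multiplicity is `-1`, and `-Δ`
supplies exactly this omitted term. Hence Kanev minus diagonal has coefficient `(λg, λ) - (λ, λ) -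
1` on every `C_g`, and adding `(λ, λ) + 1` times the trace leaves `(λg, λ)`. -/

noncomputable section

namespace SchurKanev

open Filter Set

/-! ### Local behaviour of holomorphic maps, read in charts. -/

section local_theory

variable {A B : Type*} [TopologicalSpace A] [ChartedSpace ℂ A]
  [TopologicalSpace B] [ChartedSpace ℂ B]

theorem IsHolomorphic.analyticAt {f : A → B} (hf : IsHolomorphic f) (a : A) :
    AnalyticAt ℂ (chartAt ℂ (f a) ∘ f ∘ (chartAt ℂ a).symm) (chartAt ℂ a a) := by
  have h := (contMDiffAt_iff.1 (hf a)).2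
  have h' : ContDiffAt ℂ ω (chartAt ℂ (f a) ∘ f ∘ (chartAt ℂ a).symm) (chartAt ℂ a a) := by
    simpa [contDiffWithinAt_univ] using h
  exact h'.analyticAt

/-- A punctured disc in `ℂ` is connected; this is why removing finitely many points does not
disconnect a Riemann surface. -/
theorem exists_preconnected_punctured_nhds {a : A} {s : Set A} (hs : s ∈ 𝓝[≠] a) :
    ∃ t ∈ 𝓝[≠] a, t ⊆ s ∧ IsPreconnected t ∧ t.Nonempty := by
  set e := chartAt ℂ a with he
  have ha : a ∈ e.source := mem_chart_source ℂ a
  rw [mem_nhdsWithin_iff_exists_mem_nhds_inter] at hs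
  obtain ⟨u, hu, hus⟩ := hs
  have hu' : e.symm ⁻¹' (u) ∩ e.target ∈ 𝓝 (e a) := by
    refine inter_mem ?_ (e.open_target.mem_nhds (e.map_source ha))
    apply (e.continuousAt_symm (e.map_source ha)).preimage_mem_nhds
    rwa [e.left_inv ha]
  obtain ⟨r, hr, hru⟩ := Metric.mem_nhds_iff.1 hu'
  set b : Set ℂ := Metric.ball (e a) r \ {e a} with hb
  have hbt : b ⊆ e.target := fun w hw => (hru hw.1).2
  -- Polar coordinates present the punctured disc as a continuous image of the connected set `(0, r)
  -- × ℝ`.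
  have hbc : b = (fun p : ℝ × ℝ => e a + p.1 * Complex.exp (p.2 * Complex.I)) ''
      (Ioo 0 r ×ˢ univ) := by
    ext w
    constructor
    · rintro ⟨hw, hw'⟩
      refine ⟨(‖w - e a‖, Complex.arg (w - e a)), ⟨⟨?_, ?_⟩, mem_univ _⟩, ?_⟩
      · exact norm_pos_iff.2 (sub_ne_zero.2 hw')
      · simpa [dist_eq_norm] using hw
      · simp [Complex.norm_mul_exp_arg_mul_I]
    · rintro ⟨⟨x, y⟩, ⟨⟨hx, hx'⟩, -⟩, rfl⟩
      refine ⟨?_, ?_⟩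
      · simp [dist_eq_norm, Complex.norm_exp_ofReal_mul_I, abs_of_pos hx, hx']
      · simp [hx.ne', Complex.exp_ne_zero]
  have hbp : IsPreconnected b := by
    rw [hbc]
    refine (isPreconnected_Ioo.prod isPreconnected_univ).image _ (Continuous.continuousOn ?_)
    fun_prop
  have hbn : b.Nonempty := by
    rw [hbc]
    exact ⟨_, ⟨(r / 2, 0), ⟨⟨half_pos hr, half_lt_self hr⟩, mem_univ _⟩, rfl⟩⟩
  refine ⟨e.symm '' b, ?_, ?_, hbp.image _ (e.continuousOn_symm.mono hbt), hbn.image _⟩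
  · rw [mem_nhdsWithin_iff_exists_mem_nhds_inter]
    refine ⟨e.source ∩ e ⁻¹' Metric.ball (e a) r, inter_mem (e.open_source.mem_nhds ha)
      ((e.continuousAt ha).preimage_mem_nhds (Metric.ball_mem_nhds _ hr)), ?_⟩
    rintro x ⟨⟨hx, hx'⟩, hxa⟩
    exact ⟨e x, ⟨hx', fun h => hxa (e.injOn hx ha h)⟩, e.left_inv hx⟩
  · rintro _ ⟨w, hw, rfl⟩
    refine hus ⟨(hru hw.1).1, fun h => hw.2 ?_⟩
    rw [mem_singleton_iff] at h
    rw [mem_singleton_iff, ← e.right_inv (hbt hw), h]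

theorem punctured_nhds_neBot (a : A) : (𝓝[≠] a).NeBot := by
  rw [← forall_mem_nonempty_iff_neBot]
  intro s hs
  obtain ⟨t, -, hts, -, htn⟩ := exists_preconnected_punctured_nhds hs
  exact htn.mono hts

/-- Frequent agreement forces `f a = g a` by continuity, so one chart of the target serves both maps
and the one-variable identity principle applies. -/
theorem IsHolomorphic.eventually_eq [T2Space B] {f g : A → B} (hf : IsHolomorphic f)
    (hg : IsHolomorphic g) {a : A} (h : ∃ᶠ x in 𝓝[≠] a, f x = g x) :
    ∀ᶠ x in 𝓝 a, f x = g x := by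
  have hfa : f a = g a := by
    by_contra hne
    have : ∀ᶠ x in 𝓝 a, f x ≠ g x :=
      (isOpen_ne_fun hf.continuous hg.continuous).mem_nhds hne
    exact h (this.filter_mono nhdsWithin_le_nhds)
  set e := chartAt ℂ a
  have ha : a ∈ e.source := mem_chart_source ℂ a
  set c := chartAt ℂ (f a) with hc
  have hF : AnalyticAt ℂ (c ∘ f ∘ e.symm) (e a) := hf.analyticAt a
  have hG : AnalyticAt ℂ (c ∘ g ∘ e.symm) (e a) := by
    rw [hc, hfa]
    exact hg.analyticAt a
  have hsf : ∀ᶠ x in 𝓝 a, f x ∈ c.source := hf.continuous.continuousAt.preimage_mem_nhds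
    (c.open_source.mem_nhds (mem_chart_source ℂ (f a)))
  have hsg : ∀ᶠ x in 𝓝 a, g x ∈ c.source := hg.continuous.continuousAt.preimage_mem_nhds
    (c.open_source.mem_nhds (hfa ▸ mem_chart_source ℂ (f a)))
  have hsa : ∀ᶠ x in 𝓝 a, x ∈ e.source := e.open_source.mem_nhds ha
  have ht : Tendsto e (𝓝[≠] a) (𝓝[≠] (e a)) := by
    refine tendsto_nhdsWithin_iff.2 ⟨(e.continuousAt ha).mono_left nhdsWithin_le_nhds, ?_⟩
    filter_upwards [hsa.filter_mono nhdsWithin_le_nhds, self_mem_nhdsWithin] with x hx hxa h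
    exact hxa (e.injOn hx ha h)
  have hfr : ∃ᶠ w in 𝓝[≠] (e a), (c ∘ f ∘ e.symm) w = (c ∘ g ∘ e.symm) w := by
    refine ht.frequently ((h.and_eventually (hsa.filter_mono nhdsWithin_le_nhds)).mono ?_)
    rintro x ⟨hx, hxs⟩
    simp [e.left_inv hxs, hx]
  have hev := (hF.frequently_eq_iff_eventually_eq hG).1 hfr
  filter_upwards [(e.continuousAt ha).eventually hev, hsf, hsg, hsa] with x hx h1 h2 h3
  simp only [Function.comp_apply, e.left_inv h3] at hx
  exact c.injOn h1 h2 hx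

theorem IsHolomorphic.eventually_const_or_nhds_le {f : A → B} (hf : IsHolomorphic f) (a : A) :
    (∀ᶠ x in 𝓝 a, f x = f a) ∨ 𝓝 (f a) ≤ map f (𝓝 a) := by
  set e := chartAt ℂ a
  have ha : a ∈ e.source := mem_chart_source ℂ a
  set c := chartAt ℂ (f a)
  have hF : AnalyticAt ℂ (c ∘ f ∘ e.symm) (e a) := hf.analyticAt a
  have hfa : f a ∈ c.source := mem_chart_source ℂ (f a)
  have hsf : ∀ᶠ x in 𝓝 a, f x ∈ c.source := hf.continuous.continuousAt.preimage_mem_nhds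
    (c.open_source.mem_nhds hfa)
  have hsa : ∀ᶠ x in 𝓝 a, x ∈ e.source := e.open_source.mem_nhds ha
  rcases hF.eventually_constant_or_nhds_le_map_nhds with h | h
  · left
    filter_upwards [(e.continuousAt ha).eventually h, hsf, hsa] with x hx h1 h3
    simp only [Function.comp_apply, e.left_inv h3, e.left_inv ha] at hx
    exact c.injOn h1 hfa hx
  · right
    intro s hs
    rw [mem_map] at hs
    have hs' : f ⁻¹' s ∩ e.source ∩ f ⁻¹' c.source ∈ 𝓝 a := inter_mem (inter_mem hs hsa) hsf
    have h1 : e '' (f ⁻¹' s ∩ e.source ∩ f ⁻¹' c.source) ∈ 𝓝 (e a) := by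
      rw [← e.map_nhds_eq ha]
      exact image_mem_map hs'
    have h2 := h (image_mem_map h1)
    simp only [Function.comp_apply, e.left_inv ha] at h2
    have h3 : c ⁻¹' _ ∈ 𝓝 (f a) := (c.continuousAt hfa).preimage_mem_nhds h2
    filter_upwards [h3, c.open_source.mem_nhds hfa] with b hb hbc
    obtain ⟨_, ⟨x, ⟨⟨hx, hxe⟩, hxc⟩, rfl⟩, hxb⟩ := hb
    simp only [e.left_inv hxe] at hxb
    rw [← c.injOn hxc hbc hxb]
    exact hx

end local_theory

/-! ### Identity theorem, open mapping theorem, complements of finite sets. -/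

section global_theory

variable {A B : Type*} [TopologicalSpace A] [ChartedSpace ℂ A]
  [TopologicalSpace B] [ChartedSpace ℂ B]

/-- The identity theorem. -/
theorem IsHolomorphic.eq_of_frequently_eq [PreconnectedSpace A] [T2Space B] {f g : A → B}
    (hf : IsHolomorphic f) (hg : IsHolomorphic g) {a : A} (h : ∃ᶠ x in 𝓝[≠] a, f x = g x) :
    f = g := by
  have hopen : IsOpen {x | ∀ᶠ y in 𝓝 x, f y = g y} := isOpen_setOfPred_eventually_nhds
  have hclosed : IsClosed {x | ∀ᶠ y in 𝓝 x, f y = g y} := by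
    rw [← closure_subset_iff_isClosed]
    intro x hx
    by_contra hxn
    apply hxn
    refine hf.eventually_eq hg ?_
    rw [mem_closure_iff_frequently] at hx
    rw [frequently_nhdsWithin_iff]
    refine hx.mono fun y hy => ⟨hy.self_of_nhds, ?_⟩
    rintro rfl
    exact hxn hy
  have huniv := IsClopen.eq_univ ⟨hclosed, hopen⟩ ⟨a, hf.eventually_eq hg h⟩
  ext x
  have : x ∈ {x | ∀ᶠ y in 𝓝 x, f y = g y} := huniv ▸ mem_univ x
  exact this.self_of_nhds

theorem IsHolomorphic.finite_eqLocus [PreconnectedSpace A] [CompactSpace A] [T2Space B]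
    {f g : A → B} (hf : IsHolomorphic f) (hg : IsHolomorphic g) (h : f ≠ g) :
    {x | f x = g x}.Finite := by
  by_contra hinf
  obtain ⟨x, hx⟩ := (Set.Infinite.exists_accPt_principal (show {x | f x = g x}.Infinite from hinf))
  exact h (hf.eq_of_frequently_eq hg (accPt_iff_frequently_nhdsNE.1 hx))

theorem isHolomorphic_const (b : B) : IsHolomorphic fun _ : A => b := contMDiff_const

theorem IsHolomorphic.finite_fibre [PreconnectedSpace A] [CompactSpace A] [T2Space B]
    {f : A → B} (hf : IsHolomorphic f) (h : ∀ b, f ≠ fun _ => b) (b : B) :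
    (f ⁻¹' {b}).Finite :=
  hf.finite_eqLocus (isHolomorphic_const b) (h b)

/-- The open mapping theorem. -/
theorem IsHolomorphic.nhds_le_map [PreconnectedSpace A] [T2Space B]
    {f : A → B} (hf : IsHolomorphic f) (h : ∀ b, f ≠ fun _ => b) (a : A) :
    𝓝 (f a) ≤ map f (𝓝 a) := by
  refine (hf.eventually_const_or_nhds_le a).resolve_left fun hc => h (f a) ?_
  have := punctured_nhds_neBot a
  exact hf.eq_of_frequently_eq (isHolomorphic_const _)
    (hc.filter_mono nhdsWithin_le_nhds).frequently

/-- A separation of the complement would extend to all of `A`: assign to each point the side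
containing a punctured neighbourhood of it. Small connected punctured neighbourhoods lie on a single
side, so the two resulting open sets cover the connected space `A` and must meet. -/
theorem isPreconnected_compl_of_finite [T1Space A] [PreconnectedSpace A] {F : Set A}
    (hF : F.Finite) : IsPreconnected Fᶜ := by
  have hFe : ∀ a : A, ∀ᶠ x in 𝓝[≠] a, x ∈ Fᶜ := by
    intro a
    have : (F \ {a})ᶜ ∈ 𝓝 a := (hF.subset sdiff_subset).isClosed.isOpen_compl.mem_nhds (by simp)
    filter_upwards [nhdsWithin_le_nhds this, self_mem_nhdsWithin] with x hx hxa hxF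
    exact hx ⟨hxF, hxa⟩
  have hop : ∀ u : Set A, IsOpen {a | ∀ᶠ x in 𝓝[≠] a, x ∈ u} := by
    intro u
    rw [isOpen_iff_mem_nhds]
    intro a ha
    obtain ⟨O, hO, haO, hOu⟩ := mem_nhdsWithin.1 (show u ∈ 𝓝[≠] a from ha)
    filter_upwards [hO.mem_nhds haO] with y hy
    rcases eq_or_ne y a with rfl | hya
    · exact ha
    · exact nhdsWithin_le_nhds (mem_of_superset
        ((hO.inter isOpen_compl_singleton).mem_nhds ⟨hy, hya⟩) hOu)
  intro u v hu hv huv hnu hnv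
  by_contra hdis
  have hmem : ∀ {w : Set A}, IsOpen w → (Fᶜ ∩ w).Nonempty →
      {a | ∀ᶠ x in 𝓝[≠] a, x ∈ w}.Nonempty := by
    rintro w hw ⟨x, -, hx⟩
    exact ⟨x, nhdsWithin_le_nhds (hw.mem_nhds hx)⟩
  obtain ⟨a, -, ha1, ha2⟩ := isPreconnected_univ (α := A) _ _ (hop u) (hop v) (by
    intro a _
    obtain ⟨t, ht, hts, htc, -⟩ := exists_preconnected_punctured_nhds (hFe a)
    by_contra hno
    simp only [mem_union, not_or] at hno
    have hu1 : (t ∩ u).Nonempty := by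
      by_contra hh
      exact hno.2 (mem_of_superset ht fun x hx =>
        (huv (hts hx)).resolve_left fun hxu => hh ⟨x, hx, hxu⟩)
    have hv1 : (t ∩ v).Nonempty := by
      by_contra hh
      exact hno.1 (mem_of_superset ht fun x hx =>
        (huv (hts hx)).resolve_right fun hxu => hh ⟨x, hx, hxu⟩)
    obtain ⟨x, hxt, hx⟩ := htc u v hu hv (hts.trans huv) hu1 hv1
    exact hdis ⟨x, hts hxt, hx⟩)
    (by simpa using hmem hu hnu) (by simpa using hmem hv hnv)
  have := punctured_nhds_neBot a
  rw [mem_ofPred_eq] at ha1 ha2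
  obtain ⟨x, h1, h2, h3⟩ := (Eventually.and ha1 (Eventually.and ha2 (hFe a))).exists
  exact hdis ⟨x, h3, h1, h2⟩

theorem dense_compl_of_finite [T1Space A] {F : Set A} (hF : F.Finite) : Dense Fᶜ := by
  intro a
  rw [mem_closure_iff_frequently]
  have := punctured_nhds_neBot a
  have : (F \ {a})ᶜ ∈ 𝓝 a := (hF.subset sdiff_subset).isClosed.isOpen_compl.mem_nhds (by simp)
  have h2 : ∀ᶠ x in 𝓝[≠] a, x ∈ Fᶜ := by
    filter_upwards [nhdsWithin_le_nhds this, self_mem_nhdsWithin] with x hx hxa hxF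
    exact hx ⟨hxF, hxa⟩
  exact h2.frequently.filter_mono nhdsWithin_le_nhds

end global_theory

/-! ### Ramification index one means local injectivity. -/

theorem ramificationIndex_eq_one_of_injOn {A B : Type*} [TopologicalSpace A] {f : A → B} {a : A}
    {N : Set A} (hN : N ∈ 𝓝 a) (hf : InjOn f N) : ramificationIndex f a = 1 := by
  have h : (⨅ N ∈ 𝓝 a, ⨆ b : B, (N ∩ f ⁻¹' {b}).encard) = 1 := by
    apply le_antisymm
    · refine (iInf₂_le N hN).trans (iSup_le fun b => ?_)
      rw [encard_le_one_iff]
      rintro x y ⟨hx, hxb⟩ ⟨hy, hyb⟩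
      exact hf hx hy (hxb.trans hyb.symm)
    · refine le_iInf₂ fun M hM => le_iSup_of_le (f a) ?_
      rw [one_le_encard_iff_nonempty]
      exact ⟨a, mem_of_mem_nhds hM, rfl⟩
  rw [ramificationIndex, h]
  rfl

theorem ramificationIndex_ne_one_of_forall {A B : Type*} [TopologicalSpace A] {f : A → B} {a : A}
    (h : ∀ N ∈ 𝓝 a, ¬ InjOn f N) : ramificationIndex f a ≠ 1 := by
  intro h1
  have h2 : (2 : ℕ∞) ≤ ⨅ N ∈ 𝓝 a, ⨆ b : B, (N ∩ f ⁻¹' {b}).encard := by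
    refine le_iInf₂ fun M hM => ?_
    have := h M hM
    simp only [InjOn, not_forall] at this
    obtain ⟨x, hx, y, hy, hxy, hne⟩ := this
    refine le_iSup_of_le (f x) ?_
    rw [← encard_pair hne]
    apply encard_le_encard
    rintro w (rfl | rfl)
    · exact ⟨hx, rfl⟩
    · exact ⟨hy, hxy.symm⟩
  -- `toNat` sends `⊤` to `0`, so the value `1` still determines the infimum.
  rw [ramificationIndex, ENat.toNat_eq_iff one_ne_zero] at h1
  rw [h1] at h2
  exact absurd h2 (by decide)

/-! ### Galois towers, free points and quotient maps. -/

/-- A Galois covering `π : Z → X` with group `W` and its intermediate covering by `H`. -/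
structure IsGaloisTower {W : Type*} [Group W] {X Y Z : Type*} [MulAction Wᵐᵒᵖ Z]
    [TopologicalSpace X] [ChartedSpace ℂ X] [TopologicalSpace Y] [ChartedSpace ℂ Y]
    [TopologicalSpace Z] [ChartedSpace ℂ Z]
    (H : Subgroup W) (π : Z → X) (φ : Z → Y) (ψ : Y → X) : Prop where
  action : ∀ g : W, IsHolomorphic fun z : Z => op g • z
  quotient : IsQuotientBy (⊤ : Subgroup W) π
  intermediate : IsQuotientBy H φ
  holomorphic : IsHolomorphic ψ
  comp : ∀ z, ψ (φ z) = π z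

/-- The points with trivial stabilizer. -/
def freePoints (W : Type*) [Group W] (Z : Type*) [MulAction Wᵐᵒᵖ Z] : Set Z :=
  {z | ∀ g : W, op g • z = z → g = 1}

theorem smul_mem_freePoints {W : Type*} [Group W] {Z : Type*} [MulAction Wᵐᵒᵖ Z] {z : Z}
    (hz : z ∈ freePoints W Z) (w : W) : op w • z ∈ freePoints W Z := by
  intro g hg
  have : op (w * g * w⁻¹) • z = z := by
    rw [op_mul, op_mul, mul_smul, mul_smul, hg, op_inv, inv_smul_smul]
  have := hz _ this
  rw [mul_inv_eq_one] at this
  simpa using this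

theorem smul_injective_of_mem_freePoints {W : Type*} [Group W] {Z : Type*} [MulAction Wᵐᵒᵖ Z]
    {z : Z} (hz : z ∈ freePoints W Z) {g g' : W} (h : op g • z = op g' • z) : g = g' := by
  have : op (g * g'⁻¹) • z = z := by rw [op_mul, mul_smul, h, op_inv, inv_smul_smul]
  exact mul_inv_eq_one.1 (hz _ this)

section quotient

variable {W : Type*} [Group W] {Z Q : Type*} [MulAction Wᵐᵒᵖ Z]
  [TopologicalSpace Z] [ChartedSpace ℂ Z] [TopologicalSpace Q] [ChartedSpace ℂ Q]
  {H : Subgroup W} {p : Z → Q}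

theorem IsQuotientBy.apply_smul (hp : IsQuotientBy H p) {h : W} (hh : h ∈ H) (z : Z) :
    p (op h • z) = p z :=
  ((hp.fibre z _).2 ⟨h, hh, rfl⟩).symm

theorem IsQuotientBy.isQuotientMap [CompactSpace Z] [T2Space Q] (hp : IsQuotientBy H p) :
    Topology.IsQuotientMap p :=
  hp.holomorphic.continuous.isClosedMap.isQuotientMap hp.holomorphic.continuous hp.surjective

theorem IsQuotientBy.isOpenMap [CompactSpace Z] [T2Space Q] (hp : IsQuotientBy H p)
    (hc : ∀ g : W, Continuous fun z : Z => op g • z) : IsOpenMap p := by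
  intro O hO
  rw [← hp.isQuotientMap.isOpen_preimage]
  have : p ⁻¹' (p '' O) = ⋃ h ∈ H, (fun z : Z => op h • z) ⁻¹' O := by
    ext z
    simp only [mem_preimage, mem_image, mem_iUnion, exists_prop]
    constructor
    · rintro ⟨z', hz', h⟩
      obtain ⟨k, hk, rfl⟩ := (hp.fibre z z').1 h.symm
      exact ⟨k, hk, hz'⟩
    · rintro ⟨h, hh, hz⟩
      exact ⟨_, hz, hp.apply_smul hh z⟩
  rw [this]
  exact isOpen_biUnion fun h _ => hO.preimage (hc h)

end quotient

/-! ### Branch locus as the image of the non-free points, and lifting of paths. -/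

namespace IsGaloisTower

variable {W : Type*} [Group W] {X Y Z : Type*} [MulAction Wᵐᵒᵖ Z]
    [TopologicalSpace X] [ChartedSpace ℂ X] [TopologicalSpace Y] [ChartedSpace ℂ Y]
    [TopologicalSpace Z] [ChartedSpace ℂ Z]
    {H : Subgroup W} {π : Z → X} {φ : Z → Y} {ψ : Y → X}

theorem continuous_smul (T : IsGaloisTower H π φ ψ) (g : W) : Continuous fun z : Z => op g • z :=
  (T.action g).continuous

theorem continuousConstSMul (T : IsGaloisTower H π φ ψ) : ContinuousConstSMul Wᵐᵒᵖ Z :=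
  ⟨fun g => T.continuous_smul g.unop⟩

theorem map_smul (T : IsGaloisTower H π φ ψ) (g : W) (z : Z) : π (op g • z) = π z :=
  T.quotient.apply_smul (Subgroup.mem_top g) z

theorem exists_smul_eq (T : IsGaloisTower H π φ ψ) {z z' : Z} (h : π z = π z') :
    ∃ g : W, z' = op g • z := by
  obtain ⟨g, -, hg⟩ := (T.quotient.fibre z z').1 h
  exact ⟨g, hg⟩

theorem mem_freePoints_congr (T : IsGaloisTower H π φ ψ) {z z' : Z} (h : π z = π z')
    (hz : z ∈ freePoints W Z) : z' ∈ freePoints W Z := by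
  obtain ⟨g, rfl⟩ := T.exists_smul_eq h
  exact smul_mem_freePoints hz g

section compact

variable [Finite W] [IsCompactRiemannSurface X] [IsCompactRiemannSurface Y]
  [IsCompactRiemannSurface Z] [FaithfulSMul Wᵐᵒᵖ Z]

omit [Finite W] [IsCompactRiemannSurface X] [IsCompactRiemannSurface Y] in
theorem finite_fixedPoints (T : IsGaloisTower H π φ ψ) {g : W} (hg : g ≠ 1) :
    {z : Z | op g • z = z}.Finite := by
  refine (T.action g).finite_eqLocus (g := id) contMDiff_id fun h => hg ?_
  have : op g = (1 : Wᵐᵒᵖ) := FaithfulSMul.eq_of_smul_eq_smul (α := Z) fun z => by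
    rw [one_smul]
    exact congrFun h z
  exact op_injective this

omit [IsCompactRiemannSurface X] [IsCompactRiemannSurface Y] in
theorem finite_compl_freePoints (T : IsGaloisTower H π φ ψ) : (freePoints W Z)ᶜ.Finite := by
  have : (freePoints W Z)ᶜ ⊆ ⋃ g ∈ {g : W | g ≠ 1}, {z : Z | op g • z = z} := by
    intro z hz
    simp only [freePoints, mem_compl_iff, mem_ofPred_eq, not_forall] at hz
    obtain ⟨g, hg, hg1⟩ := hz
    exact mem_biUnion hg1 hg
  exact ((toFinite _).biUnion fun g hg => T.finite_fixedPoints hg).subset this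

omit [IsCompactRiemannSurface X] [IsCompactRiemannSurface Y] [FaithfulSMul Wᵐᵒᵖ Z] in
-- Finite group actions are properly discontinuous. The local injectivity of `π` and `ψ` at free
-- points comes from this neighbourhood.
theorem exists_nhds_free (T : IsGaloisTower H π φ ψ) {z : Z} (hz : z ∈ freePoints W Z) :
    ∃ N ∈ 𝓝 z, ∀ (g : W), ∀ x ∈ N, op g • x ∈ N → g = 1 := by
  have := T.continuousConstSMul
  have : Finite Wᵐᵒᵖ := Finite.of_equiv W opEquiv
  obtain ⟨N, hN, h⟩ := ProperlyDiscontinuousSMul.exists_nhds_image_smul_eq_self Wᵐᵒᵖ z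
  exact ⟨N, hN, fun g x hx hgx => hz g (h (op g) ⟨_, ⟨x, hx, rfl⟩, hgx⟩)⟩

omit [IsCompactRiemannSurface X] [IsCompactRiemannSurface Y] in
-- Near a free point each orbit is met at most once. Near a fixed point of some `g ≠ 1`, the points
-- `x` and `x ^ g` lie in the same fibre and are distinct for general `x`, so no neighbourhood maps
-- injectively.
theorem apply_mem_branchLocus_iff (T : IsGaloisTower H π φ ψ) {z : Z} :
    π z ∈ branchLocus π ↔ z ∉ freePoints W Z := by
  constructor
  · rintro ⟨z', hz', h⟩ hz
    obtain ⟨N, hN, hfree⟩ := T.exists_nhds_free (T.mem_freePoints_congr h.symm hz)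
    refine hz' (ramificationIndex_eq_one_of_injOn hN fun x hx y hy hxy => ?_)
    obtain ⟨g, rfl⟩ := T.exists_smul_eq hxy
    rw [hfree g x hx hy, op_one, one_smul]
  · intro hz
    refine ⟨z, ramificationIndex_ne_one_of_forall fun N hN hinj => ?_, rfl⟩
    simp only [freePoints, mem_ofPred_eq, not_forall] at hz
    obtain ⟨g, hg, hg1⟩ := hz
    have h1 : (fun z : Z => op g • z) ⁻¹' N ∈ 𝓝 z := by
      apply (T.continuous_smul g).continuousAt.preimage_mem_nhds
      rwa [hg]
    have := punctured_nhds_neBot z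
    have h2 : ∀ᶠ x in 𝓝[≠] z, x ∉ {z : Z | op g • z = z} := by
      by_contra hc
      rw [not_eventually] at hc
      simp only [not_not, mem_ofPred_eq] at hc
      have hid := (T.action g).eq_of_frequently_eq (g := id) contMDiff_id hc
      refine (T.finite_fixedPoints hg1).not_infinite ?_
      have : {z : Z | op g • z = z} = univ := eq_univ_of_forall fun x => congrFun hid x
      -- If `Z` were finite, the complement of `Z`, which is empty, would be dense.
      rw [this, ← compl_empty]
      intro hfin
      have hd := dense_compl_of_finite (A := Z) hfin
      simp only [compl_empty, compl_univ] at hd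
      simpa using hd z
    obtain ⟨x, hx, hxN, hgx⟩ := (h2.and ((Filter.Eventually.and hN h1).filter_mono
      nhdsWithin_le_nhds)).exists
    exact hx (hinj hgx hxN (T.map_smul g x))

omit [IsCompactRiemannSurface X] [FaithfulSMul Wᵐᵒᵖ Z] in
-- Since `φ` is open, a neighbourhood of `z` meeting each `W`-orbit at most once has as image a
-- neighbourhood of `φ z`, and `ψ` is injective there.
theorem exists_nhds_injOn (T : IsGaloisTower H π φ ψ) {z : Z} (hz : z ∈ freePoints W Z) :
    ∃ M ∈ 𝓝 (φ z), InjOn ψ M := by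
  obtain ⟨N, hN, hfree⟩ := T.exists_nhds_free hz
  refine ⟨φ '' N, (T.intermediate.isOpenMap T.continuous_smul).image_mem_nhds hN, ?_⟩
  rintro _ ⟨x, hx, rfl⟩ _ ⟨y, hy, rfl⟩ hxy
  rw [T.comp, T.comp] at hxy
  obtain ⟨g, rfl⟩ := T.exists_smul_eq hxy
  rw [hfree g x hx hy, op_one, one_smul]

omit [IsCompactRiemannSurface X] [IsCompactRiemannSurface Y] in
theorem isPathConnected_freePoints (T : IsGaloisTower H π φ ψ) :
    IsPathConnected (freePoints W Z) := by
  have := ChartedSpace.locallyPathConnectedSpace ℂ Z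
  have hfin := T.finite_compl_freePoints
  have hopen : IsOpen (freePoints W Z) := by
    simpa using hfin.isClosed.isOpen_compl
  have h1 := isPreconnected_compl_of_finite hfin
  have h2 := (dense_compl_of_finite hfin).nonempty
  rw [compl_compl] at h1 h2
  exact hopen.isConnected_iff_isPathConnected.1 ⟨h2, h1⟩

omit [IsCompactRiemannSurface Y] in
/-- Paths avoiding the branch locus lift to the Galois covering. -/
theorem exists_path_lift (T : IsGaloisTower H π φ ψ) {z : Z} {ξ ξ' : X} (γ : Path ξ ξ')
    (hz : π z = ξ) (hγ : ∀ t, γ t ∈ (branchLocus π)ᶜ) :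
    ∃ (z' : Z) (δ : Path z z'), ∀ t, π (δ t) = γ t := by
  have := T.continuousConstSMul
  have : Finite Wᵐᵒᵖ := Finite.of_equiv W opEquiv
  -- The complement of the branch locus is exactly the part of the quotient over which a properly
  -- discontinuous action gives a covering map.
  have hU : π '' {e | MulAction.stabilizer Wᵐᵒᵖ e = ⊥} = (branchLocus π)ᶜ := by
    ext x
    obtain ⟨e, rfl⟩ := T.quotient.surjective x
    rw [mem_compl_iff, T.apply_mem_branchLocus_iff, not_not]
    have key : ∀ e : Z, MulAction.stabilizer Wᵐᵒᵖ e = ⊥ ↔ e ∈ freePoints W Z := by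
      intro e
      rw [Subgroup.eq_bot_iff_forall]
      exact ⟨fun h g hg => op_injective (h (op g) hg),
        fun h g hg => unop_injective (h g.unop hg)⟩
    constructor
    · rintro ⟨e', he', h⟩
      exact T.mem_freePoints_congr h ((key e').1 he')
    · exact fun he => ⟨e, (key e).2 he, rfl⟩
  have hcov : IsCoveringMapOn π (branchLocus π)ᶜ := by
    rw [← hU]
    refine T.quotient.isQuotientMap.isCoveringMapOn_of_properlyDiscontinuousSMul (G := Wᵐᵒᵖ) ?_
    intro e₁ e₂
    constructor
    · intro h
      obtain ⟨g, hg⟩ := T.exists_smul_eq h.symm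
      exact ⟨op g, hg.symm⟩
    · rintro ⟨g, rfl⟩
      exact T.map_smul g.unop e₂
  have hz0 : z ∈ π ⁻¹' (branchLocus π)ᶜ := by
    have := hγ 0
    rwa [γ.source, ← hz] at this
  obtain ⟨Γ, h1, h2⟩ := hcov.isCoveringMap_restrictPreimage.exists_path_lifts
    ⟨fun t => ⟨γ t, hγ t⟩, by fun_prop⟩ ⟨z, hz0⟩ (Subtype.ext (by simp [hz]))
  refine ⟨Γ 1, ⟨⟨fun t => Γ t, by fun_prop⟩, by simp [h2], rfl⟩, fun t => ?_⟩
  have := congrArg Subtype.val (congrFun h1 t)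
  simpa using this

omit [IsCompactRiemannSurface X] in
/-- Lifts to `Y` of paths avoiding the branch locus are unique. -/
theorem path_lift_unique (T : IsGaloisTower H π φ ψ) {y y₁ y₂ : Y} {γ : unitInterval → X}
    (hγ : ∀ t, γ t ∈ (branchLocus π)ᶜ) (δ₁ : Path y y₁) (δ₂ : Path y y₂)
    (h₁ : ∀ t, ψ (δ₁ t) = γ t) (h₂ : ∀ t, ψ (δ₂ t) = γ t) : y₁ = y₂ := by
  set V : Set Y := ψ ⁻¹' (branchLocus π)ᶜ
  -- Uniqueness needs no covering property of `ψ`: local injectivity together with `Y` Hausdorff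
  -- makes lifts that agree at `0` agree on the whole interval.
  have hinj : IsLocallyInjective fun v : V => ψ v := by
    rintro ⟨y, hy⟩
    obtain ⟨z, rfl⟩ := T.intermediate.surjective y
    have hz : z ∈ freePoints W Z := by
      rw [mem_preimage, T.comp, mem_compl_iff, T.apply_mem_branchLocus_iff, not_not] at hy
      exact hy
    obtain ⟨M, hM, hMi⟩ := T.exists_nhds_injOn hz
    obtain ⟨O, hOM, hO, hzO⟩ := mem_nhds_iff.1 hM
    refine ⟨Subtype.val ⁻¹' O, hO.preimage continuous_subtype_val, hzO, ?_⟩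
    intro a ha b hb hab
    exact Subtype.ext (hMi (hOM ha) (hOM hb) hab)
  have hsep : IsSeparatedMap fun v : V => ψ v := T2Space.isSeparatedMap _
  have := hsep.eq_of_comp_eq hinj (A := unitInterval)
    (g₁ := fun t => ⟨δ₁ t, show ψ (δ₁ t) ∈ _ from h₁ t ▸ hγ t⟩)
    (g₂ := fun t => ⟨δ₂ t, show ψ (δ₂ t) ∈ _ from h₂ t ▸ hγ t⟩)
    (by fun_prop) (by fun_prop) (by ext t; simp [h₁, h₂]) 0 (by simp)
  have h := congrArg Subtype.val (congrFun this 1)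
  simpa using h

end compact

end IsGaloisTower

/-! ### Orbit curves in `Y × Y` and their classification by double cosets. -/

theorem infinite_of_riemannSurface (A : Type*) [TopologicalSpace A] [ChartedSpace ℂ A]
    [T1Space A] [Nonempty A] : Infinite A := by
  by_contra h
  rw [not_infinite_iff_finite] at h
  have hd := dense_compl_of_finite (A := A) (toFinite univ)
  obtain ⟨a⟩ := ‹Nonempty A›
  simpa using hd a

/-- The image in `Y × Y` of the graph of `g`. -/
def orbitCurve {W : Type*} [Group W] {Y Z : Type*} [MulAction Wᵐᵒᵖ Z] (φ : Z → Y) (g : W) :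
    Set (Y × Y) :=
  range fun z => (φ z, φ (op g • z))

namespace IsGaloisTower

variable {W : Type*} [Group W] {X Y Z : Type*} [MulAction Wᵐᵒᵖ Z]
    [TopologicalSpace X] [ChartedSpace ℂ X] [TopologicalSpace Y] [ChartedSpace ℂ Y]
    [TopologicalSpace Z] [ChartedSpace ℂ Z]
    {H : Subgroup W} {π : Z → X} {φ : Z → Y} {ψ : Y → X}

theorem continuous_orbitMap (T : IsGaloisTower H π φ ψ) (g : W) :
    Continuous fun z => (φ z, φ (op g • z)) :=
  T.intermediate.holomorphic.continuous.prodMk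
    (T.intermediate.holomorphic.continuous.comp (T.continuous_smul g))

theorem orbitCurve_subset (T : IsGaloisTower H π φ ψ) {g : W} {p : Y × Y}
    (hp : p ∈ orbitCurve φ g) : ψ p.1 = ψ p.2 := by
  obtain ⟨z, rfl⟩ := hp
  simp [T.comp, T.map_smul]

theorem orbitCurve_eq_of_mul_eq (T : IsGaloisTower H π φ ψ) {g g' h h' : W} (hh : h ∈ H)
    (hh' : h' ∈ H) (heq : h * g = g' * h') : orbitCurve φ g = orbitCurve φ g' := by
  have key : ∀ {g g' h h' : W}, h ∈ H → h' ∈ H → h * g = g' * h' →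
      orbitCurve φ g' ⊆ orbitCurve φ g := by
    rintro g g' h h' hh hh' heq _ ⟨z, rfl⟩
    refine ⟨op h • z, ?_⟩
    simp only [T.intermediate.apply_smul hh, ← mul_smul, ← op_mul, heq]
    rw [op_mul, mul_smul, T.intermediate.apply_smul hh']
  refine (key (H.inv_mem hh) (H.inv_mem hh') ?_).antisymm (key hh hh' heq)
  rw [inv_mul_eq_iff_eq_mul, ← mul_assoc, heq, mul_inv_cancel_right]

/-- At a free point a group element is determined by the image of the point, so an equality of
points becomes an equality in `W`. Consequently orbit curves of different double cosets do not meet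
over the free locus. -/
theorem mul_eq_of_mem_orbitCurve (T : IsGaloisTower H π φ ψ) {g g' : W} {z : Z}
    (hz : z ∈ freePoints W Z) (h : (φ z, φ (op g • z)) ∈ orbitCurve φ g') :
    ∃ h ∈ H, ∃ h' ∈ H, h * g' = g * h' := by
  obtain ⟨z', hz'⟩ := h
  rw [Prod.mk.injEq] at hz'
  obtain ⟨h, hh, rfl⟩ := (T.intermediate.fibre z z').1 hz'.1.symm
  obtain ⟨h', hh', h2⟩ := (T.intermediate.fibre _ _).1 hz'.2.symm
  refine ⟨h, hh, h', hh', smul_injective_of_mem_freePoints hz ?_⟩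
  rw [op_mul, op_mul, mul_smul, mul_smul, h2]

section compact

variable [Finite W] [IsCompactRiemannSurface X] [IsCompactRiemannSurface Y]
  [IsCompactRiemannSurface Z] [FaithfulSMul Wᵐᵒᵖ Z]

omit [IsCompactRiemannSurface X] [IsCompactRiemannSurface Y] in
theorem nonempty_freePoints (T : IsGaloisTower H π φ ψ) : (freePoints W Z).Nonempty :=
  T.isPathConnected_freePoints.nonempty

omit [IsCompactRiemannSurface X] [IsCompactRiemannSurface Y] in
theorem dense_freePoints (T : IsGaloisTower H π φ ψ) : Dense (freePoints W Z) := by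
  simpa using dense_compl_of_finite T.finite_compl_freePoints

omit [IsCompactRiemannSurface X] [IsCompactRiemannSurface Y] in
theorem isOpen_freePoints (T : IsGaloisTower H π φ ψ) : IsOpen (freePoints W Z) := by
  simpa using T.finite_compl_freePoints.isClosed.isOpen_compl

omit [IsCompactRiemannSurface X] [IsCompactRiemannSurface Y] in
theorem orbitCurve_eq_iff (T : IsGaloisTower H π φ ψ) {g g' : W} :
    orbitCurve φ g = orbitCurve φ g' ↔ ∃ h ∈ H, ∃ h' ∈ H, h * g = g' * h' := by
  constructor
  · intro h
    obtain ⟨z, hz⟩ := T.nonempty_freePoints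
    refine T.mul_eq_of_mem_orbitCurve hz ?_
    rw [h]
    exact ⟨z, rfl⟩
  · rintro ⟨h, hh, h', hh', heq⟩
    exact T.orbitCurve_eq_of_mul_eq hh hh' heq

omit [Finite W] [IsCompactRiemannSurface X] [FaithfulSMul Wᵐᵒᵖ Z] in
theorem isClosed_orbitCurve (T : IsGaloisTower H π φ ψ) (g : W) : IsClosed (orbitCurve φ g) :=
  (isCompact_range (T.continuous_orbitMap g)).isClosed

omit [IsCompactRiemannSurface X] [IsCompactRiemannSurface Y] [IsCompactRiemannSurface Z]
  [FaithfulSMul Wᵐᵒᵖ Z] in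
theorem finite_fibre (T : IsGaloisTower H π φ ψ) (x : X) : (ψ ⁻¹' {x}).Finite := by
  obtain ⟨z, rfl⟩ := T.quotient.surjective x
  refine (finite_range fun g : W => φ (op g • z)).subset ?_
  intro y hy
  obtain ⟨z', rfl⟩ := T.intermediate.surjective y
  obtain ⟨g, rfl⟩ := T.exists_smul_eq ((T.comp z').symm.trans hy).symm
  exact ⟨g, rfl⟩

omit [IsCompactRiemannSurface X] [IsCompactRiemannSurface Y] in
theorem finite_compl_image_freePoints (T : IsGaloisTower H π φ ψ) :
    (φ '' freePoints W Z)ᶜ.Finite := by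
  refine (T.finite_compl_freePoints.image φ).subset ?_
  intro y hy
  obtain ⟨z, rfl⟩ := T.intermediate.surjective y
  exact ⟨z, fun hz => hy ⟨z, hz, rfl⟩, rfl⟩

omit [Finite W] [IsCompactRiemannSurface X] [IsCompactRiemannSurface Y]
  [IsCompactRiemannSurface Z] [FaithfulSMul Wᵐᵒᵖ Z] in
theorem exists_orbitMap_eq (T : IsGaloisTower H π φ ψ) {p : Y × Y} (hp : ψ p.1 = ψ p.2)
    (hp1 : p.1 ∈ φ '' freePoints W Z) :
    ∃ g : W, ∃ z ∈ freePoints W Z, p = (φ z, φ (op g • z)) := by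
  obtain ⟨z, hz, h1⟩ := hp1
  obtain ⟨z', h2⟩ := T.intermediate.surjective p.2
  rw [← h1, ← h2, T.comp, T.comp] at hp
  obtain ⟨g, rfl⟩ := T.exists_smul_eq hp
  exact ⟨g, z, hz, Prod.ext h1.symm h2.symm⟩

omit [IsCompactRiemannSurface X] in
/-- A holomorphically parametrized curve of pairs with the same image in `X` is one of the
orbit curves. -/
theorem exists_range_eq_orbitCurve (T : IsGaloisTower H π φ ψ) {R : Type*} [TopologicalSpace R]
    [ChartedSpace ℂ R] [IsCompactRiemannSurface R] {f f' : R → Y} (hf : IsHolomorphic f)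
    (hf' : IsHolomorphic f') (hnt : (range fun r => (f r, f' r)).Nontrivial)
    (hψ : ∀ r, ψ (f r) = ψ (f' r)) :
    ∃ g : W, (range fun r => (f r, f' r)) = orbitCurve φ g := by
  have hRinf : Infinite R := infinite_of_riemannSurface R
  have hFc : Continuous fun r => (f r, f' r) := hf.continuous.prodMk hf'.continuous
  -- If `f` were constant, `f'` would take values in one finite fibre of `ψ`, so it would be
  -- constant too and the curve would be a point.
  have hnc : ∀ b, f ≠ fun _ => b := by
    rintro b rfl
    by_cases hc : ∃ b', f' = fun _ => b'
    · obtain ⟨b', rfl⟩ := hc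
      obtain ⟨_, ⟨r, rfl⟩, _, ⟨r', rfl⟩, hne⟩ := hnt
      exact hne rfl
    · push Not at hc
      have hfin : (f' ⁻¹' (ψ ⁻¹' {ψ b})).Finite :=
        (T.finite_fibre (ψ b)).preimage' fun y _ => hf'.finite_fibre hc y
      refine hfin.not_infinite ?_
      have : f' ⁻¹' (ψ ⁻¹' {ψ b}) = univ := eq_univ_of_forall fun r => (hψ r).symm
      rw [this]
      exact infinite_univ
  set F : Set R := f ⁻¹' (φ '' freePoints W Z)ᶜ with hFdef
  have hF : F.Finite := T.finite_compl_image_freePoints.preimage' fun y _ => hf.finite_fibre hnc y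
  have hcover : ∀ r ∈ Fᶜ, ∃ g : W, ∃ z ∈ freePoints W Z, (f r, f' r) = (φ z, φ (op g • z)) := by
    intro r hr
    refine T.exists_orbitMap_eq (hψ r) ?_
    simpa [hFdef] using hr
  obtain ⟨r₀, hr₀⟩ := (dense_compl_of_finite hF).nonempty
  obtain ⟨g, z₀, hz₀, hrz₀⟩ := hcover r₀ hr₀
  refine ⟨g, Subset.antisymm ?_ ?_⟩
  · have hA : IsClosed ((fun r => (f r, f' r)) ⁻¹' orbitCurve φ g) :=
      (T.isClosed_orbitCurve g).preimage hFc
    -- Away from the finite set `F`, the orbit curve of `g` and the union of the others pull back to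
    -- disjoint closed sets which cover the connected set `Fᶜ`; hence only the one through `r₀`
    -- occurs.
    have hB : IsClosed (⋃ g' ∈ {g' : W | orbitCurve φ g' ≠ orbitCurve φ g},
        (fun r => (f r, f' r)) ⁻¹' orbitCurve φ g') :=
      (toFinite _).isClosed_biUnion fun g' _ => (T.isClosed_orbitCurve g').preimage hFc
    have hsub : Fᶜ ⊆ (fun r => (f r, f' r)) ⁻¹' orbitCurve φ g := by
      intro r hr
      by_contra hrA
      obtain ⟨g', z', hz', hrz'⟩ := hcover r hr
      have hne : orbitCurve φ g' ≠ orbitCurve φ g := by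
        intro h
        apply hrA
        rw [mem_preimage, ← h, hrz']
        exact ⟨z', rfl⟩
      obtain ⟨s, hs, hsA, hsB⟩ := isPreconnected_closed_iff.1
        (isPreconnected_compl_of_finite hF) _ _ hA hB (by
          intro s hs
          obtain ⟨k, z, hz, hsz⟩ := hcover s hs
          have hmem : (f s, f' s) ∈ orbitCurve φ k := ⟨z, hsz.symm⟩
          by_cases hk : orbitCurve φ k = orbitCurve φ g
          · left
            rwa [mem_preimage, ← hk]
          · right
            exact mem_biUnion (show k ∈ {g' : W | orbitCurve φ g' ≠ orbitCurve φ g} from hk) hmem)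
        ⟨r₀, hr₀, z₀, hrz₀.symm⟩
        ⟨r, hr, mem_biUnion (show g' ∈ {g' : W | orbitCurve φ g' ≠ orbitCurve φ g} from hne)
          ⟨z', hrz'.symm⟩⟩
      simp only [mem_iUnion] at hsB
      obtain ⟨k', hk', hsk'⟩ := hsB
      obtain ⟨k, z, hz, hsz⟩ := hcover s hs
      rw [mem_preimage, hsz] at hsA hsk'
      have h1 := T.orbitCurve_eq_iff.2 (T.mul_eq_of_mem_orbitCurve hz hsA)
      have h2 := T.orbitCurve_eq_iff.2 (T.mul_eq_of_mem_orbitCurve hz hsk')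
      exact hk' (h2.trans h1.symm)
    have huniv : (fun r => (f r, f' r)) ⁻¹' orbitCurve φ g = univ := by
      rw [← hA.closure_eq, ← univ_subset_iff, ← (dense_compl_of_finite hF).closure_eq]
      exact closure_mono hsub
    rintro _ ⟨r, rfl⟩
    have : r ∈ (fun r => (f r, f' r)) ⁻¹' orbitCurve φ g := huniv ▸ mem_univ r
    exact this
  · have hC : IsClosed (range fun r => (f r, f' r)) := (isCompact_range hFc).isClosed
    have hA : IsClosed ((fun z => (φ z, φ (op g • z))) ⁻¹' range fun r => (f r, f' r)) :=
      hC.preimage (T.continuous_orbitMap g)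
    -- For `z'` near `z`, the open mapping theorem for `f` gives `r'` with `f r' = φ z'`; then `f'
    -- r'` and `φ (op g • z')` have the same image under `ψ` and lie in a set where `ψ` is
    -- injective. The locus is therefore open as well as closed in the connected set of free points.
    have hu : IsOpen (((fun z => (φ z, φ (op g • z))) ⁻¹' range fun r => (f r, f' r)) ∩
        freePoints W Z) := by
      rw [isOpen_iff_mem_nhds]
      rintro z ⟨⟨r, hr⟩, hz⟩
      rw [Prod.mk.injEq] at hr
      obtain ⟨M, hM, hMi⟩ := T.exists_nhds_injOn (smul_mem_freePoints hz g)
      have hN : f' ⁻¹' M ∈ 𝓝 r := hf'.continuous.continuousAt.preimage_mem_nhds (hr.2 ▸ hM)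
      have hfN : f '' (f' ⁻¹' M) ∈ 𝓝 (φ z) := hr.1 ▸ hf.nhds_le_map hnc r (image_mem_map hN)
      have h1 : φ ⁻¹' (f '' (f' ⁻¹' M)) ∈ 𝓝 z :=
        T.intermediate.holomorphic.continuous.continuousAt.preimage_mem_nhds hfN
      have h2 : (fun z => φ (op g • z)) ⁻¹' M ∈ 𝓝 z :=
        (T.intermediate.holomorphic.continuous.comp
          (T.continuous_smul g)).continuousAt.preimage_mem_nhds hM
      filter_upwards [h1, h2, T.isOpen_freePoints.mem_nhds hz] with z' hz1 hz2 hz3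
      obtain ⟨r', hr', hfr'⟩ := hz1
      refine ⟨⟨r', Prod.ext hfr' (hMi hr' hz2 ?_)⟩, hz3⟩
      rw [← hψ, hfr', T.comp, T.comp, T.map_smul]
    have hsub : freePoints W Z ⊆
        (fun z => (φ z, φ (op g • z))) ⁻¹' range fun r => (f r, f' r) := by
      intro z hz
      by_contra hzA
      obtain ⟨s, -, hs1, hs2⟩ := T.isPathConnected_freePoints.isConnected.isPreconnected _ _ hu
        hA.isOpen_compl (fun s hs => (em _).imp (fun h => ⟨h, hs⟩) id)
        ⟨z₀, hz₀, ⟨r₀, hrz₀⟩, hz₀⟩ ⟨z, hz, hzA⟩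
      exact hs2 hs1.1
    have huniv : ((fun z => (φ z, φ (op g • z))) ⁻¹' range fun r => (f r, f' r)) = univ := by
      rw [← hA.closure_eq, ← univ_subset_iff, ← T.dense_freePoints.closure_eq]
      exact closure_mono hsub
    rintro _ ⟨z, rfl⟩
    have : z ∈ (fun z => (φ z, φ (op g • z))) ⁻¹' range fun r => (f r, f' r) := huniv ▸ mem_univ z
    exact this

end compact

end IsGaloisTower

section curves

variable {W : Type*} [Group W] {X Y Z : Type u} [MulAction Wᵐᵒᵖ Z]
    [TopologicalSpace X] [ChartedSpace ℂ X] [TopologicalSpace Y] [ChartedSpace ℂ Y]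
    [TopologicalSpace Z] [ChartedSpace ℂ Z] {H : Subgroup W} {π : Z → X} {φ : Z → Y} {ψ : Y → X}
    [Finite W] [IsCompactRiemannSurface X] [IsCompactRiemannSurface Y]
    [IsCompactRiemannSurface Z] [FaithfulSMul Wᵐᵒᵖ Z]

omit [Finite W] [IsCompactRiemannSurface X] [FaithfulSMul Wᵐᵒᵖ Z] in
theorem IsGaloisTower.isIrreducibleCurve_orbitCurve (T : IsGaloisTower H π φ ψ) (g : W) :
    IsIrreducibleCurve (orbitCurve φ g) := by
  obtain ⟨y, y', hne⟩ := (nontrivial_of_riemannSurface (A := Y)).exists_pair_ne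
  obtain ⟨z, rfl⟩ := T.intermediate.surjective y
  obtain ⟨z', rfl⟩ := T.intermediate.surjective y'
  exact ⟨⟨_, ⟨z, rfl⟩, _, ⟨z', rfl⟩, fun h => hne (congrArg Prod.fst h)⟩,
    Z, inferInstance, inferInstance, inferInstance, φ, fun z => φ (op g • z),
    T.intermediate.holomorphic, T.intermediate.holomorphic.comp (T.action g), rfl⟩

omit [IsCompactRiemannSurface X] in
theorem IsGaloisTower.exists_eq_orbitCurve (T : IsGaloisTower H π φ ψ) {C : Set (Y × Y)}
    (hC : IsIrreducibleCurve C) (hψ : ∀ p ∈ C, ψ p.1 = ψ p.2) :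
    ∃ g : W, C = orbitCurve φ g := by
  obtain ⟨hnt, R, _, _, hR, f, f', hf, hf', rfl⟩ := hC
  exact T.exists_range_eq_orbitCurve hf hf' hnt fun r => hψ _ ⟨r, rfl⟩

end curves

/-! ### Generic values and coefficients of the push-forward, diagonal and trace divisors. -/

/-- Two values taken at all but finitely many points of an infinite set are both taken at a common
point. -/
theorem genericValue_eq {M : Type*} {C : Set M} (hC : C.Infinite) {v : M → ℚ} {q : ℚ}
    (h : {p ∈ C | v p ≠ q}.Finite) : genericValue C v = q := by
  have hex : ∃ q : ℚ, {p ∈ C | v p ≠ q}.Finite := ⟨q, h⟩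
  rw [genericValue, dif_pos hex]
  obtain ⟨p, hp, hpn⟩ := (hC.sdiff (h.union hex.choose_spec)).nonempty
  simp only [mem_union, mem_ofPred_eq, not_or, not_and, not_not] at hpn
  exact (hpn.2 hp).symm.trans (hpn.1 hp)

theorem finsum_mem_smul_single_apply {α : Type*} {P : α → Prop} (hP : {a | P a}.Finite)
    (v : α → ℚ) (a : α) :
    (∑ᶠ (x : α) (_ : P x), v x • (Finsupp.single x 1 : α →₀ ℚ)) a =
      open Classical in if P a then v a else 0 := by
  classical
  have h := finsum_mem_eq_finite_toFinset_sum
    (fun x => v x • (Finsupp.single x 1 : α →₀ ℚ)) hP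
  simp only [mem_ofPred_eq] at h
  rw [h, Finsupp.finsetSum_apply]
  simp [Finsupp.single_apply]

section divisors

variable {A B A' B' : Type u} [TopologicalSpace A] [ChartedSpace ℂ A] [TopologicalSpace B]
  [ChartedSpace ℂ B] [TopologicalSpace A'] [ChartedSpace ℂ A'] [TopologicalSpace B']
  [ChartedSpace ℂ B']

theorem primeDivisor_eq_single {C : Set (A × B)} (hC : IsIrreducibleCurve C) :
    primeDivisor C = Finsupp.single (⟨C, hC⟩ : IrreducibleCurve A B) 1 :=
  dif_pos hC

theorem pushforward_primeDivisor {C : Set (A × B)} (hC : IsIrreducibleCurve C) (f : A → A')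
    (g : B → B') : pushforward f g (primeDivisor C) =
      mapDegree (Prod.map f g) C • primeDivisor (Prod.map f g '' C) := by
  rw [primeDivisor_eq_single hC]
  exact (Finsupp.linearCombination_single ℚ _ _).trans (one_smul ℚ _)

theorem pullback_primeDivisor {D : Set (A × B)} (hD : IsIrreducibleCurve D) (g : B' → B) :
    pullback g (primeDivisor D) =
      ∑ᶠ (C : IrreducibleCurve A B') (_ : C.1 ⊆ Prod.map id g ⁻¹' D),
        genericValue C.1 (fun p => (ramificationIndex g p.2 : ℚ)) •
          (Finsupp.single C 1 : Correspondence A B') := by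
  rw [primeDivisor_eq_single hD]
  exact (Finsupp.linearCombination_single ℚ _ _).trans (one_smul ℚ _)

end divisors

theorem image_graph_eq_orbitCurve {W : Type*} [Group W] {Y Z : Type*} [MulAction Wᵐᵒᵖ Z]
    (φ : Z → Y) (g : W) :
    Prod.map φ φ '' {p : Z × Z | p.2 = op g • p.1} = orbitCurve φ g := by
  ext p
  constructor
  · rintro ⟨⟨z, z'⟩, hz, rfl⟩
    exact ⟨z, by rw [show z' = op g • z from hz]; rfl⟩
  · rintro ⟨z, rfl⟩
    exact ⟨(z, op g • z), rfl, rfl⟩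

/-- The degree of the graph of `g` over its image in the square of the quotient by `H`. -/
def graphDegree {W : Type*} [Group W] (H : Subgroup W) (g : W) : ℕ :=
  {h : W | h ∈ H ∧ ∃ h' ∈ H, h * g = g * h'}.ncard

namespace IsGaloisTower

variable {W : Type*} [Group W] {X Y Z : Type u} [MulAction Wᵐᵒᵖ Z]
    [TopologicalSpace X] [ChartedSpace ℂ X] [TopologicalSpace Y] [ChartedSpace ℂ Y]
    [TopologicalSpace Z] [ChartedSpace ℂ Z] {H : Subgroup W} {π : Z → X} {φ : Z → Y} {ψ : Y → X}
    [Finite W] [IsCompactRiemannSurface X] [IsCompactRiemannSurface Y]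
    [IsCompactRiemannSurface Z] [FaithfulSMul Wᵐᵒᵖ Z]

omit [Finite W] [IsCompactRiemannSurface X] [IsCompactRiemannSurface Z] [FaithfulSMul Wᵐᵒᵖ Z] in
theorem infinite_orbitCurve (T : IsGaloisTower H π φ ψ) (g : W) :
    (orbitCurve φ g).Infinite := by
  have := infinite_of_riemannSurface Y
  refine Infinite.of_image Prod.fst ?_
  have : Prod.fst '' orbitCurve φ g = univ := by
    refine eq_univ_of_forall fun y => ?_
    obtain ⟨z, rfl⟩ := T.intermediate.surjective y
    exact ⟨_, ⟨z, rfl⟩, rfl⟩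
  rw [this]
  exact infinite_univ

omit [IsCompactRiemannSurface X] in
theorem genericValue_orbitCurve (T : IsGaloisTower H π φ ψ) {g : W} {v : Y × Y → ℚ} {q : ℚ}
    (h : ∀ z ∈ freePoints W Z, v (φ z, φ (op g • z)) = q) :
    genericValue (orbitCurve φ g) v = q := by
  refine genericValue_eq (T.infinite_orbitCurve g)
    ((T.finite_compl_freePoints.image fun z => (φ z, φ (op g • z))).subset ?_)
  rintro _ ⟨⟨z, rfl⟩, hz⟩
  exact ⟨z, fun hfree => hz (h z hfree), rfl⟩

omit [IsCompactRiemannSurface X] in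
-- The points of the graph over the image of a free point `z` are those over `z ^ h` with `h ∈ H ∩ g
-- H g⁻¹`, and distinct `h` give distinct points.
theorem mapDegree_graph (T : IsGaloisTower H π φ ψ) (g : W) :
    mapDegree (Prod.map φ φ) {p : Z × Z | p.2 = op g • p.1} = graphDegree H g := by
  rw [mapDegree, image_graph_eq_orbitCurve]
  refine T.genericValue_orbitCurve fun z hz => ?_
  have hset : {p : Z × Z | p.2 = op g • p.1} ∩ Prod.map φ φ ⁻¹' {(φ z, φ (op g • z))} =
      (fun h : W => (op h • z, op g • op h • z)) '' {h : W | h ∈ H ∧ ∃ h' ∈ H, h * g = g * h'} := by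
    ext ⟨a, b⟩
    simp only [mem_inter_iff, mem_ofPred_eq, mem_preimage, Prod.map_apply, mem_singleton_iff,
      Prod.mk.injEq, mem_image]
    constructor
    · rintro ⟨rfl, h1, h2⟩
      obtain ⟨h, hh, rfl⟩ := (T.intermediate.fibre _ _).1 h1.symm
      obtain ⟨h', hh', h3⟩ := (T.intermediate.fibre _ _).1 h2.symm
      refine ⟨h, ⟨hh, h', hh', smul_injective_of_mem_freePoints hz ?_⟩, rfl, rfl⟩
      rw [op_mul, op_mul, mul_smul, mul_smul, h3]
    · rintro ⟨h, ⟨hh, h', hh', heq⟩, rfl, rfl⟩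
      refine ⟨rfl, T.intermediate.apply_smul hh z, ?_⟩
      rw [← mul_smul, ← op_mul, heq, op_mul, mul_smul, T.intermediate.apply_smul hh']
  rw [hset, ncard_image_of_injective, graphDegree]
  intro h h' heq
  exact smul_injective_of_mem_freePoints hz (congrArg Prod.fst heq)

/-- The image in `Y × Y` of the graph of `g`, as an irreducible curve. -/
def irreducibleOrbitCurve (T : IsGaloisTower H π φ ψ) (g : W) : IrreducibleCurve Y Y :=
  ⟨orbitCurve φ g, T.isIrreducibleCurve_orbitCurve g⟩

omit [IsCompactRiemannSurface X] in
theorem irreducibleOrbitCurve_eq_iff (T : IsGaloisTower H π φ ψ) {g g' : W} :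
    T.irreducibleOrbitCurve g = T.irreducibleOrbitCurve g' ↔
      ∃ h ∈ H, ∃ h' ∈ H, h * g = g' * h' :=
  Subtype.ext_iff.trans T.orbitCurve_eq_iff

omit [IsCompactRiemannSurface X] in
theorem pushforward_graph (T : IsGaloisTower H π φ ψ) (g : W) :
    pushforward φ φ (graph fun z : Z => op g • z) =
      (graphDegree H g : ℚ) • Finsupp.single (T.irreducibleOrbitCurve g) 1 := by
  rw [graph, pushforward_primeDivisor (isIrreducibleCurve_graph (T.action g)),
    T.mapDegree_graph, image_graph_eq_orbitCurve,
    primeDivisor_eq_single (T.isIrreducibleCurve_orbitCurve g)]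
  rfl

omit [Finite W] [IsCompactRiemannSurface X] [FaithfulSMul Wᵐᵒᵖ Z] in
theorem diagonal_eq (T : IsGaloisTower H π φ ψ) :
    diagonal Y = Finsupp.single (T.irreducibleOrbitCurve 1) 1 := by
  have h : {p : Y × Y | p.1 = p.2} = orbitCurve φ (1 : W) := by
    ext ⟨a, b⟩
    constructor
    · intro hab
      obtain ⟨z, rfl⟩ := T.intermediate.surjective a
      exact ⟨z, by simpa using hab⟩
    · rintro ⟨z, hz⟩
      rw [← hz]
      simp
  rw [diagonal, h, primeDivisor, dif_pos (T.isIrreducibleCurve_orbitCurve 1)]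
  rfl

end IsGaloisTower

theorem pushforward_id_diagonal {X Y : Type u} [TopologicalSpace X] [ChartedSpace ℂ X]
    [TopologicalSpace Y] [ChartedSpace ℂ Y] [IsCompactRiemannSurface Y] (ψ : Y → X) :
    pushforward id ψ (diagonal Y) = graph ψ := by
  have h1 := isIrreducibleCurve_diagonal (A := Y)
  have himg : Prod.map id ψ '' {p : Y × Y | p.1 = p.2} = {p : Y × X | p.2 = ψ p.1} := by
    ext ⟨a, b⟩
    constructor
    · rintro ⟨⟨y, y'⟩, hy, h⟩
      rw [← h, ← show y = y' from hy]
      rfl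
    · intro h
      exact ⟨(a, a), rfl, Prod.ext rfl h.symm⟩
  have hdeg : mapDegree (Prod.map id ψ) {p : Y × Y | p.1 = p.2} = 1 := by
    rw [mapDegree, himg]
    have := infinite_of_riemannSurface Y
    have hinf : {p : Y × X | p.2 = ψ p.1}.Infinite := by
      refine Infinite.of_image Prod.fst ?_
      have : Prod.fst '' {p : Y × X | p.2 = ψ p.1} = univ :=
        eq_univ_of_forall fun y => ⟨(y, ψ y), rfl, rfl⟩
      rw [this]
      exact infinite_univ
    refine genericValue_eq hinf ?_
    convert finite_empty
    rw [eq_empty_iff_forall_notMem]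
    rintro ⟨a, b⟩ ⟨hab, hne⟩
    apply hne
    have : {p : Y × Y | p.1 = p.2} ∩ Prod.map id ψ ⁻¹' {(a, b)} = {(a, a)} := by
      ext ⟨c, d⟩
      simp only [mem_inter_iff, mem_ofPred_eq, mem_preimage, Prod.map_apply, id_eq,
        mem_singleton_iff, Prod.mk.injEq]
      constructor
      · rintro ⟨rfl, rfl, -⟩
        exact ⟨rfl, rfl⟩
      · rintro ⟨rfl, rfl⟩
        exact ⟨rfl, rfl, hab.symm⟩
    rw [this, ncard_singleton, Nat.cast_one]
  rw [diagonal, pushforward_primeDivisor h1, hdeg, himg, one_smul, graph]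

namespace IsGaloisTower

variable {W : Type*} [Group W] {X Y Z : Type u} [MulAction Wᵐᵒᵖ Z]
    [TopologicalSpace X] [ChartedSpace ℂ X] [TopologicalSpace Y] [ChartedSpace ℂ Y]
    [TopologicalSpace Z] [ChartedSpace ℂ Z] {H : Subgroup W} {π : Z → X} {φ : Z → Y} {ψ : Y → X}
    [Finite W] [IsCompactRiemannSurface X] [IsCompactRiemannSurface Y]
    [IsCompactRiemannSurface Z] [FaithfulSMul Wᵐᵒᵖ Z]

omit [IsCompactRiemannSurface X] in
theorem mem_range_of_subset (T : IsGaloisTower H π φ ψ) {C : IrreducibleCurve Y Y}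
    (hψ : ∀ p ∈ C.1, ψ p.1 = ψ p.2) : C ∈ range T.irreducibleOrbitCurve := by
  obtain ⟨g, hg⟩ := T.exists_eq_orbitCurve C.2 hψ
  exact ⟨g, Subtype.ext hg.symm⟩

omit [IsCompactRiemannSurface X] in
-- The preimage of the graph of `ψ` is the set of pairs with equal image in `X`, so its components
-- are the orbit curves; each has ramification `1` because `ψ` is injective near images of free
-- points.
theorem traceCorrespondence_apply (T : IsGaloisTower H π φ ψ) (C : IrreducibleCurve Y Y) :
    traceCorrespondence ψ C =
      open Classical in if C ∈ range T.irreducibleOrbitCurve then 1 else 0 := by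
  classical
  have hiff : ∀ C : IrreducibleCurve Y Y, C.1 ⊆ Prod.map id ψ ⁻¹' {p : Y × X | p.2 = ψ p.1} ↔
      C ∈ range T.irreducibleOrbitCurve := by
    intro C
    constructor
    · exact fun h => T.mem_range_of_subset fun p hp => (h hp).symm
    · rintro ⟨g, rfl⟩ p hp
      exact (T.orbitCurve_subset hp).symm
  rw [traceCorrespondence, pushforward_id_diagonal, graph,
    pullback_primeDivisor (isIrreducibleCurve_graph T.holomorphic)]
  rw [finsum_mem_smul_single_apply ?_ fun C : IrreducibleCurve Y Y =>
    genericValue C.1 fun p => (ramificationIndex ψ p.2 : ℚ)]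
  · simp only [hiff]
    split_ifs with h
    · obtain ⟨g, rfl⟩ := h
      refine T.genericValue_orbitCurve fun z hz => ?_
      obtain ⟨M, hM, hMi⟩ := T.exists_nhds_injOn (smul_mem_freePoints hz g)
      rw [ramificationIndex_eq_one_of_injOn hM hMi, Nat.cast_one]
    · rfl
  · simp only [hiff]
    exact finite_range _

/-! ### Labels of the fibres and coefficients of the Kanev correspondence. -/

section kanev

variable {V : Type*} [AddCommGroup V] [Module ℚ V] {ρ : Representation ℚ Wᵐᵒᵖ V} {lam : V}

omit [IsCompactRiemannSurface X] in
-- Uniqueness of lifts pins down the `epsilon` in `μ`. Keeping `ξ` apart from `ψ y` lets one path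
-- serve all points of a fibre.
theorem μ_eq_of_path (T : IsGaloisTower H π φ ψ) (m : KanevMarking ρ lam π φ ψ) {y y' : Y}
    {ξ : X} (hξ : ψ y = ξ) (hU : ξ ∈ (branchLocus π)ᶜ) (ε : Path y y')
    (hε : ∀ t, ψ (ε t) = m.path ξ hU t) : m.μ y = m.ν y' := by
  subst hξ
  rw [KanevMarking.μ, dif_pos hU]
  congr 1
  obtain ⟨ε', hε'⟩ := @Classical.epsilon_spec_aux Y ⟨y⟩ (fun y' =>
      ∃ ε : Path y y', ∀ t, ψ (ε t) = m.path (ψ y) hU t) ⟨y', ε, hε⟩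
  exact T.path_lift_unique (m.path_mem _ hU) ε' ε hε' hε

omit [IsCompactRiemannSurface X] [IsCompactRiemannSurface Y] in
theorem z₀_mem_freePoints (T : IsGaloisTower H π φ ψ) (m : KanevMarking ρ lam π φ ψ) :
    m.z₀ ∈ freePoints W Z := by
  have := m.ξ₀_mem
  rwa [← m.π_z₀, mem_compl_iff, T.apply_mem_branchLocus_iff, not_not] at this

omit [IsCompactRiemannSurface X] [IsCompactRiemannSurface Y] in
-- A path in the free locus from `z₀` to `z₀ ^ w` projects to a loop avoiding the branch locus and
-- to a lift of it in `Y`, so equivariance determines the label from that of `φ z₀`.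
theorem ν_smul_z₀ (T : IsGaloisTower H π φ ψ) (m : KanevMarking ρ lam π φ ψ) (w : W) :
    m.ν (φ (op w • m.z₀)) = ρ (op w⁻¹) lam := by
  have hz := T.z₀_mem_freePoints m
  obtain ⟨δ, hδ⟩ := T.isPathConnected_freePoints.joinedIn _ hz _ (smul_mem_freePoints hz w)
  have hγ : Continuous fun t => π (δ t) :=
    T.quotient.holomorphic.continuous.comp δ.continuous
  have hε : Continuous fun t => φ (δ t) :=
    T.intermediate.holomorphic.continuous.comp δ.continuous
  conv_rhs => rw [← m.ν_base]
  refine m.equivariant w (φ m.z₀) _ ⟨⟨fun t => π (δ t), hγ⟩, ?_, ?_⟩ δ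
    ⟨⟨fun t => φ (δ t), hε⟩, ?_, ?_⟩ ?_ ?_ ?_
  · simp [m.π_z₀]
  · simp [T.map_smul, m.π_z₀]
  · simp
  · simp
  · intro t
    show π (δ t) ∈ (branchLocus π)ᶜ
    rw [mem_compl_iff, T.apply_mem_branchLocus_iff, not_not]
    exact hδ t
  · exact fun t => rfl
  · exact fun t => T.comp _

/-- Lift the chosen path to one from `z` to `z₀ ^ w`. Its translate by `g` projects to the lift in
`Y` starting at `φ (z ^ g)`, so the same `w` works for the whole fibre. -/
theorem exists_μ_eq (T : IsGaloisTower H π φ ψ) (m : KanevMarking ρ lam π φ ψ) {z : Z}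
    (hz : z ∈ freePoints W Z) :
    ∃ w : W, ∀ g : W, m.μ (φ (op g • z)) = ρ (op w⁻¹) (ρ (op g⁻¹) lam) := by
  have hU : π z ∈ (branchLocus π)ᶜ := by
    rwa [mem_compl_iff, T.apply_mem_branchLocus_iff, not_not]
  obtain ⟨z₁, δ, hδ⟩ := T.exists_path_lift (m.path (π z) hU) rfl (m.path_mem _ hU)
  have h1 : π m.z₀ = π z₁ := by
    have := hδ 1
    rw [δ.target, Path.target] at this
    rw [m.π_z₀, this]
  obtain ⟨w, rfl⟩ := T.exists_smul_eq h1
  refine ⟨w, fun g => ?_⟩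
  have hε : Continuous fun t => φ (op g • δ t) :=
    T.intermediate.holomorphic.continuous.comp ((T.continuous_smul g).comp δ.continuous)
  have h2 := T.μ_eq_of_path m (y := φ (op g • z)) (y' := φ (op g • op w • m.z₀)) (ξ := π z)
    (by rw [T.comp, T.map_smul]) hU ⟨⟨fun t => φ (op g • δ t), hε⟩, by simp, by simp⟩
    (fun t => by
      show ψ (φ (op g • δ t)) = _
      rw [T.comp, T.map_smul, hδ])
  rw [h2, ← mul_smul, ← op_mul, T.ν_smul_z₀, mul_inv_rev, op_mul, map_mul]
  rfl

/-- Invariance cancels the common `w` and then turns `(λ, λg⁻¹)` into `(λg, λ)`; no trace of the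
marking remains. -/
theorem multiplicity_orbitMap (T : IsGaloisTower H π φ ψ) (m : KanevMarking ρ lam π φ ψ)
    {B : LinearMap.BilinForm ℚ V}
    (hinv : ∀ (g : W) (v w : V), B (ρ (op g) v) (ρ (op g) w) = B v w) {z : Z}
    (hz : z ∈ freePoints W Z) (g : W) :
    m.multiplicity B (φ z, φ (op g • z)) = B (ρ (op g) lam) lam - B lam lam - 1 := by
  obtain ⟨w, hw⟩ := T.exists_μ_eq m hz
  have h1 := hw 1
  rw [op_one, one_smul, inv_one, op_one, map_one, Module.End.one_apply] at h1
  rw [KanevMarking.multiplicity, h1, hw g, hinv, ← hinv g lam, ← Module.End.mul_apply, ← map_mul,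
    ← op_mul, inv_mul_cancel, op_one, map_one, Module.End.one_apply]

/-- The Kanev set lies in the finite, hence closed, union of the orbit curves of positive
multiplicity, and it contains the dense part of each of them coming from free points. -/
theorem subset_closure_kanevSet_iff (T : IsGaloisTower H π φ ψ) (m : KanevMarking ρ lam π φ ψ)
    {B : LinearMap.BilinForm ℚ V}
    (hinv : ∀ (g : W) (v w : V), B (ρ (op g) v) (ρ (op g) w) = B v w)
    (C : IrreducibleCurve Y Y) :
    C.1 ⊆ closure (m.kanevSet B) ↔
      ∃ g : W, T.irreducibleOrbitCurve g = C ∧ 0 < B (ρ (op g) lam) lam - B lam lam - 1 := by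
  constructor
  · intro hC
    have hψc := T.holomorphic.continuous
    have hcl : closure (m.kanevSet B) ⊆ {p | ψ p.1 = ψ p.2} :=
      closure_minimal (fun p hp => hp.2.2.1)
        (isClosed_eq (hψc.comp continuous_fst) (hψc.comp continuous_snd))
    obtain ⟨g, rfl⟩ := T.mem_range_of_subset fun p hp => hcl (hC hp)
    have hcl' : closure (m.kanevSet B) ⊆
        ⋃ g' ∈ {g' : W | 0 < B (ρ (op g') lam) lam - B lam lam - 1}, orbitCurve φ g' := by
      refine closure_minimal ?_
        ((toFinite _).isClosed_biUnion fun g' _ => T.isClosed_orbitCurve g')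
      rintro p ⟨hp1, -, hp, hpos⟩
      obtain ⟨g', z, hz, rfl⟩ := T.exists_orbitMap_eq hp (by
        obtain ⟨z, hz⟩ := T.intermediate.surjective p.1
        refine ⟨z, ?_, hz⟩
        rw [← hz, T.comp, mem_compl_iff, T.apply_mem_branchLocus_iff, not_not] at hp1
        exact hp1)
      rw [T.multiplicity_orbitMap m hinv hz] at hpos
      exact mem_biUnion (show g' ∈ {g' : W | _} from hpos) ⟨z, rfl⟩
    obtain ⟨z, hz⟩ := T.nonempty_freePoints
    have hmem := hcl' (hC ⟨z, rfl⟩)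
    simp only [mem_iUnion] at hmem
    obtain ⟨g', hg', hzg'⟩ := hmem
    exact ⟨g', T.irreducibleOrbitCurve_eq_iff.2 (T.mul_eq_of_mem_orbitCurve hz hzg'), hg'⟩
  · rintro ⟨g, rfl, hg⟩
    have himg : (fun z => (φ z, φ (op g • z))) '' freePoints W Z ⊆ m.kanevSet B := by
      rintro _ ⟨z, hz, rfl⟩
      have hU : π z ∈ (branchLocus π)ᶜ := by
        rwa [mem_compl_iff, T.apply_mem_branchLocus_iff, not_not]
      refine ⟨?_, ?_, ?_, ?_⟩
      · simpa only [T.comp] using hU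
      · simpa only [T.comp, T.map_smul] using hU
      · simp only [T.comp, T.map_smul]
      · rwa [T.multiplicity_orbitMap m hinv hz]
    rintro _ ⟨z, rfl⟩
    exact closure_mono himg (image_closure_subset_closure_image (T.continuous_orbitMap g)
      ⟨z, T.dense_freePoints z, rfl⟩)

theorem kanev_apply (T : IsGaloisTower H π φ ψ) (m : KanevMarking ρ lam π φ ψ)
    {B : LinearMap.BilinForm ℚ V}
    (hinv : ∀ (g : W) (v w : V), B (ρ (op g) v) (ρ (op g) w) = B v w)
    (C : IrreducibleCurve Y Y) :
    m.kanev B C = open Classical in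
      if ∃ g : W, T.irreducibleOrbitCurve g = C ∧ 0 < B (ρ (op g) lam) lam - B lam lam - 1
      then genericValue C.1 (m.multiplicity B) else 0 := by
  classical
  rw [KanevMarking.kanev, finsum_mem_smul_single_apply ?_ fun C : IrreducibleCurve Y Y =>
    genericValue C.1 (m.multiplicity B)]
  · simp only [T.subset_closure_kanevSet_iff m hinv]
  · simp only [T.subset_closure_kanevSet_iff m hinv]
    refine (finite_range T.irreducibleOrbitCurve).subset ?_
    rintro C ⟨g, hg, -⟩
    exact ⟨g, hg⟩

end kanev

end IsGaloisTower

/-! ### Counting in a double coset. -/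

section counting

variable {W : Type*} [Group W]

/-- If `h g₀ k = g`, then `(h a) g = h g₀ b = g (k⁻¹ b)`. So `(h, k) ↦ h a` maps into `H ∩ g H g⁻¹`;
the factor `a` corrects for `g` being only in the double coset of `g₀`. -/
theorem graphDegree_eq_card [Fintype W] [DecidableEq W] (H : Subgroup W) [Fintype H] {g g₀ a b : W}
    (ha : a ∈ H) (hb : b ∈ H) (hg : a * g = g₀ * b) :
    graphDegree H g = (Finset.univ.filter fun p : H × H => (p.1 : W) * g₀ * (p.2 : W) = g).card := by
  have hg' : g = a⁻¹ * g₀ * b := by rw [mul_assoc, ← hg, inv_mul_cancel_left]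
  rw [graphDegree, ← ncard_coe_finset]
  symm
  refine ncard_congr (fun p _ => (p.1 : W) * a) ?_ ?_ ?_
  · rintro ⟨⟨h, hh⟩, ⟨k, hk⟩⟩ hp
    simp only [Finset.coe_filter, Finset.mem_univ, true_and, mem_ofPred_eq] at hp
    refine ⟨H.mul_mem hh ha, k⁻¹ * b, H.mul_mem (H.inv_mem hk) hb, ?_⟩
    rw [mul_assoc, hg, ← hp]
    group
  · rintro ⟨⟨h, hh⟩, ⟨k, hk⟩⟩ ⟨⟨h', hh'⟩, ⟨k', hk'⟩⟩ hp hp' heq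
    simp only [Finset.coe_filter, Finset.mem_univ, true_and, mem_ofPred_eq] at hp hp'
    have h1 : h = h' := mul_right_cancel heq
    subst h1
    have h2 : k = k' := mul_left_cancel (hp.trans hp'.symm)
    subst h2
    rfl
  · rintro x ⟨hx, k, hk, hxk⟩
    refine ⟨(⟨x * a⁻¹, H.mul_mem hx (H.inv_mem ha)⟩, ⟨b * k⁻¹, H.mul_mem hb (H.inv_mem hk)⟩),
      ?_, by simp⟩
    simp only [Finset.coe_filter, Finset.mem_univ, true_and, mem_ofPred_eq]
    calc x * a⁻¹ * g₀ * (b * k⁻¹) = x * (a⁻¹ * g₀ * b) * k⁻¹ := by group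
      _ = g := by rw [← hg', hxk, mul_inv_cancel_right]

/-- The map `(h, k) ↦ h g₀ k` sends `H × H` into the double coset, with fibre of size `graphDegree H
g` over `g`. -/
theorem sum_graphDegree [Fintype W] (H : Subgroup W) (g₀ : W) {s : Finset W}
    (hs : ∀ g, g ∈ s ↔ ∃ a ∈ H, ∃ b ∈ H, a * g = g₀ * b) :
    ∑ g ∈ s, graphDegree H g = Nat.card H ^ 2 := by
  classical
  rw [Finset.sum_congr rfl fun g hg => by
    obtain ⟨a, ha, b, hb, h⟩ := (hs g).1 hg
    exact graphDegree_eq_card H ha hb h]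
  rw [← Finset.card_eq_sum_card_fiberwise (s := (Finset.univ : Finset (H × H)))
    (f := fun p => (p.1 : W) * g₀ * (p.2 : W))]
  · rw [Finset.card_univ, Fintype.card_prod, Nat.card_eq_fintype_card, sq]
  · rintro ⟨⟨h, hh⟩, ⟨k, hk⟩⟩ -
    refine (hs _).2 ⟨h⁻¹, H.inv_mem hh, k, hk, ?_⟩
    group

end counting

/-! ### Values of the normalized form on the orbit of the weight. -/

section weights

variable {W : Type*} [Group W] {V : Type*} [AddCommGroup V] [Module ℚ V]
  {ρ : Representation ℚ Wᵐᵒᵖ V} {S : Submodule ℤ V} {lam : V} {B : LinearMap.BilinForm ℚ V}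

theorem IsIntegralInvariantForm.eq_of_mul_eq (hB : IsIntegralInvariantForm ρ S lam B)
    {g g' a b : W} (ha : a ∈ weightStabilizer ρ lam) (hb : b ∈ weightStabilizer ρ lam)
    (h : a * g = g' * b) : B (ρ (op g) lam) lam = B (ρ (op g') lam) lam := by
  have ha' : ρ (op a) lam = lam := ha
  have hb' : ρ (op b) lam = lam := hb
  calc B (ρ (op g) lam) lam = B (ρ (op (a * g)) lam) lam := by
        rw [op_mul, map_mul, Module.End.mul_apply, ha']
    _ = B (ρ (op b) (ρ (op g') lam)) (ρ (op b) lam) := by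
        rw [h, op_mul, map_mul, Module.End.mul_apply, hb']
    _ = B (ρ (op g') lam) lam := hB.invariant _ _ _

/-- Distinct weights in the orbit of `lam` have multiplicity `≥ 0`. -/
theorem IsNormalizedForm.multiplicity_nonneg (hB : IsNormalizedForm ρ S lam B)
    (hlam : IsWeight ρ S lam) {g : W} (hg : g ∉ weightStabilizer ρ lam) :
    0 ≤ B (ρ (op g) lam) lam - B lam lam - 1 := by
  obtain ⟨n, hn⟩ := hB.integral _ (hlam g)
  have hne : ρ (op g) lam - lam ≠ 0 := fun h => hg (sub_eq_zero.1 h)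
  have hneg := hB.negDef _ hne
  have h1 := hB.invariant g lam lam
  have h2 := hB.symm (ρ (op g) lam) lam
  simp only [map_sub, LinearMap.sub_apply] at hneg hn
  -- By invariance `(λg - λ, λg - λ) = 2(λ, λ) - 2(λg, λ) = -2n`, which is negative.
  have hpos : (0 : ℚ) < n := by linarith
  have : (1 : ℚ) ≤ n := by
    have : 0 < n := by exact_mod_cast hpos
    exact_mod_cast this
  linarith

end weights

end SchurKanev

end

/-! ### Comparison of coefficients. -/

theorem theorem3p5
    -- the Weyl group `W`, the lattice `S`, the weight `lam` and the normalized form `B`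
    {W : Type*} [Group W] [Fintype W] (hW : SchurKanev.IsWeylGroup W)
    {V : Type*} [AddCommGroup V] [Module ℚ V] [FiniteDimensional ℚ V]
    (ρ : Representation ℚ Wᵐᵒᵖ V) (hρ : ρ.IsIrreducible)
    (S : Submodule ℤ V) (hS : SchurKanev.IsInvariantLattice ρ S)
    (lam : V) (hlam : SchurKanev.IsWeight ρ S lam)
    (B : LinearMap.BilinForm ℚ V) (hB : SchurKanev.IsNormalizedForm ρ S lam B)
    -- the curves
    {X Y Z : Type u}
    [TopologicalSpace X] [ChartedSpace ℂ X] [SchurKanev.IsCompactRiemannSurface X]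
    [TopologicalSpace Y] [ChartedSpace ℂ Y] [SchurKanev.IsCompactRiemannSurface Y]
    [TopologicalSpace Z] [ChartedSpace ℂ Z] [SchurKanev.IsCompactRiemannSurface Z]
    -- the Galois covering `π : Z → X` with group `W`
    [MulAction Wᵐᵒᵖ Z] [FaithfulSMul Wᵐᵒᵖ Z]
    (hW_hol : ∀ g : W, SchurKanev.IsHolomorphic fun z : Z => op g • z)
    (π : Z → X) (hπ : SchurKanev.IsQuotientBy (⊤ : Subgroup W) π)
    -- the quotient `Y` of `Z` by the stabilizer of `lam`
    (φ : Z → Y) (hφ : SchurKanev.IsQuotientBy (SchurKanev.weightStabilizer ρ lam) φ)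
    (ψ : Y → X) (hψ : SchurKanev.IsHolomorphic ψ) (hψφ : ∀ z, ψ (φ z) = π z)
    -- the base points, labelling and paths used to construct the Kanev correspondence
    (m : SchurKanev.KanevMarking ρ lam π φ ψ) :
    SchurKanev.schurBar ρ lam B φ =
      (Nat.card (SchurKanev.weightStabilizer ρ lam) : ℚ) ^ 2 •
        (m.kanev B - SchurKanev.diagonal Y
          + (B lam lam + 1) • SchurKanev.traceCorrespondence ψ) := by
  classical
  have T : SchurKanev.IsGaloisTower (SchurKanev.weightStabilizer ρ lam) π φ ψ :=
    ⟨hW_hol, hπ, hφ, hψ, hψφ⟩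
  have hinv := hB.invariant
  have hstab : ∀ {g : W}, g ∈ SchurKanev.weightStabilizer ρ lam →
      B (ρ (op g) lam) lam = B lam lam := fun {g} hg => by rw [show ρ (op g) lam = lam from hg]
  have hschur : ∀ C, SchurKanev.schurBar ρ lam B φ C =
      ∑ g : W, if T.irreducibleOrbitCurve g = C then
        B (ρ (op g) lam) lam * (SchurKanev.graphDegree (SchurKanev.weightStabilizer ρ lam) g : ℚ)
      else 0 := by
    intro C
    rw [SchurKanev.schurBar, SchurKanev.schur, map_sum, Finsupp.finsetSum_apply]
    refine Finset.sum_congr rfl fun g _ => ?_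
    rw [map_smul, T.pushforward_graph]
    by_cases h : T.irreducibleOrbitCurve g = C <;> simp [h]
  ext C
  rw [hschur]
  simp only [Finsupp.smul_apply, Finsupp.add_apply, Finsupp.sub_apply, smul_eq_mul,
    T.traceCorrespondence_apply, T.diagonal_eq, T.kanev_apply m hinv, Finsupp.single_apply]
  by_cases hC : C ∈ Set.range T.irreducibleOrbitCurve
  · obtain ⟨g₀, rfl⟩ := hC
    have hval : ∀ g, T.irreducibleOrbitCurve g = T.irreducibleOrbitCurve g₀ →
        B (ρ (op g) lam) lam = B (ρ (op g₀) lam) lam := by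
      intro g hg
      obtain ⟨a, ha, b, hb, h⟩ := T.irreducibleOrbitCurve_eq_iff.1 hg
      exact hB.eq_of_mul_eq ha hb h
    have hlhs : (∑ g : W, if T.irreducibleOrbitCurve g = T.irreducibleOrbitCurve g₀ then
        B (ρ (op g) lam) lam * (SchurKanev.graphDegree (SchurKanev.weightStabilizer ρ lam) g : ℚ)
        else 0) = B (ρ (op g₀) lam) lam * (Nat.card (SchurKanev.weightStabilizer ρ lam) : ℚ) ^ 2 := by
      rw [← Finset.sum_filter, ← Nat.cast_pow,
        ← SchurKanev.sum_graphDegree (SchurKanev.weightStabilizer ρ lam) g₀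
          (s := Finset.univ.filter fun g => T.irreducibleOrbitCurve g = T.irreducibleOrbitCurve g₀)
          (fun g => by simp [T.irreducibleOrbitCurve_eq_iff]), Nat.cast_sum, Finset.mul_sum]
      refine Finset.sum_congr rfl fun g hg => ?_
      rw [hval g (Finset.mem_filter.1 hg).2]
    have hgen : SchurKanev.genericValue (T.irreducibleOrbitCurve g₀).1 (m.multiplicity B) =
        B (ρ (op g₀) lam) lam - B lam lam - 1 :=
      T.genericValue_orbitCurve fun z hz => T.multiplicity_orbitMap m hinv hz g₀
    have hpos : (∃ g : W, T.irreducibleOrbitCurve g = T.irreducibleOrbitCurve g₀ ∧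
        0 < B (ρ (op g) lam) lam - B lam lam - 1) ↔ 0 < B (ρ (op g₀) lam) lam - B lam lam - 1 :=
      ⟨fun ⟨g, hg, h⟩ => hval g hg ▸ h, fun h => ⟨g₀, rfl, h⟩⟩
    have hdiag : T.irreducibleOrbitCurve 1 = T.irreducibleOrbitCurve g₀ ↔
        g₀ ∈ SchurKanev.weightStabilizer ρ lam := by
      rw [T.irreducibleOrbitCurve_eq_iff]
      constructor
      · rintro ⟨a, ha, b, hb, h⟩
        rw [mul_one] at h
        rw [eq_mul_inv_of_mul_eq h.symm]
        exact Subgroup.mul_mem _ ha (Subgroup.inv_mem _ hb)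
      · intro h
        exact ⟨g₀, h, 1, Subgroup.one_mem _, rfl⟩
    rw [hlhs, hgen, if_pos (Set.mem_range_self g₀)]
    simp only [hpos, hdiag]
    by_cases hg : g₀ ∈ SchurKanev.weightStabilizer ρ lam
    -- On the diagonal the multiplicity is `-1`: the curve is absent from the Kanev divisor, and the
    -- term `-Δ` contributes the `-1`.
    · rw [if_pos hg, hstab hg, if_neg (by linarith)]
      ring
    · rw [if_neg hg]
      have hnn := hB.multiplicity_nonneg hlam hg
      split_ifs with h
      · ring
      -- Off the diagonal a curve is omitted only when its multiplicity is zero, so omitting it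
      -- changes nothing.
      · have : B (ρ (op g₀) lam) lam - B lam lam - 1 = 0 := le_antisymm (not_lt.1 h) hnn
        rw [show B (ρ (op g₀) lam) lam = B lam lam + 1 by linarith]
        ring
  · have h1 : ∀ g, T.irreducibleOrbitCurve g ≠ C := fun g hg => hC ⟨g, hg⟩
    simp [h1, hC]
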